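/- A virtual link diagram $D$ of $n$ components is a generic immersion of $n$ oriented circles in the plane whose double points are marked as positive classical, negative classical or virtual crossings. Two such diagrams are equivalent, $D_0\leftrightharpoons D_1$, if they are related by a finite sequence of planar isotopies, Reidemeister moves and detour moves. A detour move replaces an arc that contains only virtual crossings by any other arc with the same endpoints, all of whose crossings are virtual. The arcs of $D$ are the pieces into which its components are cut by the under-crossings; virtual crossings are ignored, and a component without under-crossings is one arc. The fundamental quandle $Q(D)$ is the quandle generated by the arcs of $D$ with one relation for each classical crossing. If $b$ is the over-crossing arc, $a$ the incoming under-crossing arc and $c$ the outgoing one, then the relation is $a*b=c$ at a positive crossing and $c*b=a$ at a negative crossing. Bar-Natan's construction associates to $D$ an $(n+1)$-component diagram $\text{Ж}(D)=D\cup\omega$ as follows. Draw each classical crossing of $D$ with both strands pointing upwards. Next to it, $\omega$ runs upwards either along the left-hand side, crossing over the lower left and then over the upper left leg of the crossing, or along the right-hand side, crossing over the lower right and then over the upper right leg. (So each such crossing contributes two classical over-crossings of $\omega$, one with each of the two strands.) The over-crossing arcs of $\omega$ obtained in this way are connected, in an arbitrary order and in an arbitrary way, to form a single component $\omega$, and all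 the other crossings of $\omega$ with $D$ and with itself are virtual. The extended fundamental quandle of $D$ is $\widetilde Q(D):=Q(\text{Ж}(D))$. **Theorem.** If $D_0\leftrightharpoons D_1$, then $\widetilde Q(D_0)\cong\widetilde Q(D_1)$ as quandles, whatever choices are made in the construction of $\text{Ж}(D_0)$ and $\text{Ж}(D_1)$. Moreover, the fundamental quandle of an $(n+1)$-component virtual link diagram with a distinguished component $\omega$ is invariant, up to isomorphism, under the $\omega$-over-crossings-commute move ($\omega$OCC), in which an arc of $\omega$ that crosses over two strands is moved across a virtual crossing of these two strands. -/

import Mathlib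

open scoped Quandles

/-! ## Quandles presented by generators and relations

The quandle operation `x * y` is written `y ◃ x` in Mathlib; Mathlib's axioms for `Quandle` are
exactly `x * x = x`, bijectivity of `(· * y)`, and `(x * y) * z = (x * z) * (y * z)`. -/

/-- Formal quandle expressions in generators `X`: `op x y` stands for `x * y`, and `inv x y` for the
unique `z` with `z * y = x`. -/
inductive QuandleTerm (X : Type) : Type
  | of (x : X) : QuandleTerm X
  | op (s t : QuandleTerm X) : QuandleTerm X
  | inv (s t : QuandleTerm X) : QuandleTerm X

/-- The smallest congruence on quandle expressions which contains the relations `R` and enforces the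
quandle axioms. -/
inductive QuandleTerm.Congr {X : Type} (R : QuandleTerm X → QuandleTerm X → Prop) :
    QuandleTerm X → QuandleTerm X → Prop
  | rel {s t : QuandleTerm X} (h : R s t) : Congr R s t
  | refl (s : QuandleTerm X) : Congr R s s
  | symm {s t : QuandleTerm X} (h : Congr R s t) : Congr R t s
  | trans {s t u : QuandleTerm X} (h : Congr R s t) (h' : Congr R t u) : Congr R s u
  | op {s s' t t' : QuandleTerm X} (h : Congr R s s') (h' : Congr R t t') :
      Congr R (.op s t) (.op s' t')
  | inv {s s' t t' : QuandleTerm X} (h : Congr R s s') (h' : Congr R t t') :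
      Congr R (.inv s t) (.inv s' t')
  | idem (s : QuandleTerm X) : Congr R (.op s s) s
  | inv_op (s t : QuandleTerm X) : Congr R (.inv (.op s t) t) s
  | op_inv (s t : QuandleTerm X) : Congr R (.op (.inv s t) t) s
  | distrib (s t u : QuandleTerm X) :
      Congr R (.op (.op s t) u) (.op (.op s u) (.op t u))

/-- The congruence as a setoid. -/
def QuandleTerm.setoid {X : Type} (R : QuandleTerm X → QuandleTerm X → Prop) :
    Setoid (QuandleTerm X) where
  r := QuandleTerm.Congr R
  iseqv := ⟨.refl, .symm, .trans⟩

/-- The quandle with generators `X` and relations `s = t` for `R s t`. -/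
def PresentedQuandle {X : Type} (R : QuandleTerm X → QuandleTerm X → Prop) : Type :=
  Quotient (QuandleTerm.setoid R)

instance PresentedQuandle.instQuandle {X : Type} (R : QuandleTerm X → QuandleTerm X → Prop) :
    Quandle (PresentedQuandle R) where
  act y x := Quotient.map₂ (sa := QuandleTerm.setoid R) (sb := QuandleTerm.setoid R)
    (sc := QuandleTerm.setoid R) QuandleTerm.op (fun _ _ h _ _ h' => .op h h') x y
  invAct y x := Quotient.map₂ (sa := QuandleTerm.setoid R) (sb := QuandleTerm.setoid R)
    (sc := QuandleTerm.setoid R) QuandleTerm.inv (fun _ _ h _ _ h' => .inv h h') x y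
  self_distrib := by
    rintro ⟨x⟩ ⟨y⟩ ⟨z⟩
    exact Quotient.sound (s := QuandleTerm.setoid R) (.distrib z y x)
  left_inv := by
    rintro ⟨y⟩ ⟨x⟩
    exact Quotient.sound (s := QuandleTerm.setoid R) (.inv_op x y)
  right_inv := by
    rintro ⟨y⟩ ⟨x⟩
    exact Quotient.sound (s := QuandleTerm.setoid R) (.op_inv x y)
  fix := by
    rintro ⟨x⟩
    exact Quotient.sound (s := QuandleTerm.setoid R) (.idem x)

namespace VirtualLink

/-! ## Virtual link diagrams

A generic immersion of oriented circles with decorated double points is recorded by the cyclic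
sequences of its passages through the double points. At a double point, rotate the plane so that
both strands point upwards: one strand runs from south-west to north-east, the other one from
south-east to north-west. The crossing is positive if the first one is the over-crossing strand,
negative if the second one is. -/

/-- The decoration of a double point. -/
inductive Kind : Type
  | pos
  | neg
  | virt
  deriving DecidableEq

/-- A passage of a link component through the double point `label`, which is decorated by `kind`.
`rising` tells which of the two strands is followed: `true` for the strand from south-west to
north-east, `false` for the strand from south-east to north-west. -/
structure Passage : Type where
  label : ℕ
  kind : Kind
  rising : Bool
  deriving DecidableEq

/-- The passage along the other strand at the same double point. -/
def Passage.mate (a : Passage) : Passage := ⟨a.label, a.kind, !a.rising⟩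

/-- Whether the passage is along the under-crossing strand of a classical crossing. -/
def Passage.isUnder : Passage → Bool
  | ⟨_, .pos, b⟩ => !b
  | ⟨_, .neg, b⟩ => b
  | ⟨_, .virt, _⟩ => false

/-- The decoration of a classical crossing with a given sign; `true` means positive. -/
def Kind.ofSign (s : Bool) : Kind := if s then .pos else .neg

/-- The over-crossing passage at the classical crossing `l` of sign `s`. -/
def overPass (l : ℕ) (s : Bool) : Passage := ⟨l, .ofSign s, s⟩

/-- The under-crossing passage at the classical crossing `l` of sign `s`. -/
def underPass (l : ℕ) (s : Bool) : Passage := ⟨l, .ofSign s, !s⟩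

/-- An oriented virtual link diagram with `n` components. The word of a component lists its passages
through classical and virtual crossings in the order in which they are met, starting from a base
point; each crossing is passed exactly twice, once along each of its two strands. (Every generic
immersion of `n` circles in the plane gives such words. The words are not required to come from a
planar immersion: diagrams on arbitrary closed oriented surfaces are allowed too.) -/
@[ext]
structure Diagram (n : ℕ) : Type where
  word : Fin n → List Passage
  nodup : ((List.finRange n).flatMap word).Nodup
  mate_mem : ∀ a ∈ (List.finRange n).flatMap word, a.mate ∈ (List.finRange n).flatMap word
  kind_eq : ∀ a ∈ (List.finRange n).flatMap word, ∀ b ∈ (List.finRange n).flatMap word,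
    a.label = b.label → a.kind = b.kind

/-! ## Moves on diagrams -/

/-- A diagram with `k` pieces of its components cut out: each of the `k` places from which a piece
has been removed occurs exactly once. -/
structure Template (n k : ℕ) : Type where
  word : Fin n → List (Passage ⊕ Fin k)
  hole_once : ∀ j : Fin k, ((List.finRange n).flatMap word).count (Sum.inr j) = 1

/-- Put the words `f j` into the empty places. -/
def Template.fill {n k : ℕ} (t : Template n k) (f : Fin k → List Passage) (i : Fin n) :
    List Passage :=
  (t.word i).flatMap (Sum.elim (fun a => [a]) f)

/-- The word `p q` or the word `q p`. -/
def ordered (d : Bool) (p q : Passage) : List Passage := if d then [p, q] else [q, p]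

/-- The words of the three strands of a triangle. The first strand passes over the second one at the
crossing `x` of sign `a`, and over the third one at the crossing `y` of sign `b`. The second and the
third strand pass each other by `mid` and `bot`, and `c` tells whether the second one is the rising
strand there. Given `a`, `b` and `c`, there are two mutually opposite positions of the three lines,
selected by `e`: the three directed lines meet their crossings in the following order. -/
def triangle (a b c e : Bool) (x y : ℕ) (mid bot : Passage) : Fin 3 → List Passage :=
  ![ordered (e == b) (overPass x a) (overPass y b),
    ordered (e == c) (underPass x a) mid,
    ordered (e == (a == (b == c))) (underPass y b) bot]

/-- The elementary moves: reparametrization, relabelling, the Reidemeister moves in all their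
oriented versions, and the detour move. -/
inductive Move {n : ℕ} : Diagram n → Diagram n → Prop
  /-- Change of the base points of the components. -/
  | rotate (D D' : Diagram n) (h : ∀ i, D.word i ~r D'.word i) : Move D D'
  /-- Change of the names of the crossings. -/
  | relabel (D D' : Diagram n) (f : Equiv.Perm ℕ)
      (h : ∀ i, D'.word i = (D.word i).map fun a => ⟨f a.label, a.kind, a.rising⟩) : Move D D'
  /-- Change of the numbering of the components. -/
  | renumber (D D' : Diagram n) (f : Equiv.Perm (Fin n)) (h : ∀ i, D'.word i = D.word (f i)) :
      Move D D'
  /-- A kink with a classical crossing of sign `s` is created. -/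
  | reidemeister1 (D D' : Diagram n) (t : Template n 1) (l : ℕ) (s b : Bool)
      (h : D.word = t.fill ![[]])
      (h' : D'.word = t.fill ![[⟨l, .ofSign s, b⟩, ⟨l, .ofSign s, !b⟩]]) : Move D D'
  /-- A strand is moved over another one; `b` tells whether the two strands run in parallel. -/
  | reidemeister2 (D D' : Diagram n) (t : Template n 2) (x y : ℕ) (s b : Bool)
      (h : D.word = t.fill ![[], []])
      (h' : D'.word = t.fill ![[overPass x s, overPass y !s],
        ordered b (underPass x s) (underPass y !s)]) : Move D D'
  /-- A triangle with three classical crossings `x`, `y` and `z` is reversed. -/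
  | reidemeister3 (D D' : Diagram n) (t : Template n 3) (x y z : ℕ) (a b c e : Bool)
      (h : D.word = t.fill (triangle a b c e x y (overPass z c) (underPass z c)))
      (h' : D'.word = t.fill (triangle a b c (!e) x y (overPass z c) (underPass z c))) : Move D D'
  /-- An arc with virtual crossings only (with passages `p`) is removed and redrawn with virtual
  crossings only (with passages `p'`); the rest of the diagram, apart from its virtual crossings
  with this arc, does not change. -/
  | detour (D D' : Diagram n) (t t' : Template n 1) (p p' : List Passage)
      (hp : ∀ a ∈ p, a.kind = .virt) (hp' : ∀ a ∈ p', a.kind = .virt)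
      (h : D.word = t.fill ![p]) (h' : D'.word = t'.fill ![p'])
      (hrest : ∀ i,
        (t.word i).filter (Sum.elim (fun a => decide (a.label ∉ p.map Passage.label))
          (fun _ => true)) =
        (t'.word i).filter (Sum.elim (fun a => decide (a.label ∉ p'.map Passage.label))
          (fun _ => true))) : Move D D'

/-- Virtual Reidemeister equivalence: the equivalence relation generated by the moves. -/
def Equivalent {n : ℕ} (D D' : Diagram n) : Prop := Relation.EqvGen Move D D'

/-- The `ω`-over-crossings-commute move on an `(n + 1)`-component diagram whose last component is
`ω`: an arc of `ω` passing over two strands is moved across a virtual crossing `z` of these. -/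
def OmegaOCC {n : ℕ} (E E' : Diagram (n + 1)) : Prop :=
  ∃ (t : Template (n + 1) 3) (x y z : ℕ) (a b c e : Bool),
    Sum.inr 0 ∈ t.word (Fin.last n) ∧
    E.word = t.fill (triangle a b c e x y ⟨z, .virt, c⟩ ⟨z, .virt, !c⟩) ∧
    E'.word = t.fill (triangle a b c (!e) x y ⟨z, .virt, c⟩ ⟨z, .virt, !c⟩)

/-! ## The fundamental quandle -/

/-- Points on the components of a diagram, away from the crossings: `⟨i, p⟩` lies on the `i`-th
component, after the first `p` passages. -/
abbrev Diagram.Point {n : ℕ} (D : Diagram n) : Type :=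
  (i : Fin n) × Fin ((D.word i).length + 1)

/-- Walking along a component without going through an under-crossing. -/
inductive Diagram.Step {n : ℕ} (D : Diagram n) : D.Point → D.Point → Prop
  /-- The first and the last point of the word of a component are its base point. -/
  | close (i : Fin n) : Step D ⟨i, 0⟩ ⟨i, Fin.last _⟩
  /-- Walking through a virtual crossing, or along the over-crossing strand of a crossing. -/
  | pass (i : Fin n) (p : Fin (D.word i).length) (h : ((D.word i).get p).isUnder = false) :
      Step D ⟨i, p.castSucc⟩ ⟨i, p.succ⟩

/-- The arcs of a diagram: the pieces into which its components are cut by the under-crossings. A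
component without under-crossings is a single arc. -/
def Diagram.Arc {n : ℕ} (D : Diagram n) : Type := Quot D.Step

/-- The generator given by the arc through a point. -/
def Diagram.gen {n : ℕ} (D : Diagram n) (x : D.Point) : QuandleTerm D.Arc :=
  .of (Quot.mk D.Step x)

/-- The relations of the fundamental quandle, one for each classical crossing `l`, at which the
over-crossing strand is the passage `p` of the component `i`, and the under-crossing strand is the
passage `q` of the component `j`: at a positive crossing, `incoming * over = outgoing`, and at a
negative crossing, `outgoing * over = incoming`. -/
inductive Diagram.CrossingRel {n : ℕ} (D : Diagram n) :
    QuandleTerm D.Arc → QuandleTerm D.Arc → Prop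
  | pos (l : ℕ) (i j : Fin n) (p : Fin (D.word i).length) (q : Fin (D.word j).length)
      (hp : (D.word i).get p = overPass l true) (hq : (D.word j).get q = underPass l true) :
      CrossingRel D (.op (D.gen ⟨j, q.castSucc⟩) (D.gen ⟨i, p.castSucc⟩)) (D.gen ⟨j, q.succ⟩)
  | neg (l : ℕ) (i j : Fin n) (p : Fin (D.word i).length) (q : Fin (D.word j).length)
      (hp : (D.word i).get p = overPass l false) (hq : (D.word j).get q = underPass l false) :
      CrossingRel D (.op (D.gen ⟨j, q.succ⟩) (D.gen ⟨i, p.castSucc⟩)) (D.gen ⟨j, q.castSucc⟩)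

/-- The fundamental quandle of a diagram. -/
abbrev FundamentalQuandle {n : ℕ} (D : Diagram n) : Type := PresentedQuandle D.CrossingRel

/-! ## Bar-Natan's construction

Around each classical crossing of `D`, drawn with both strands pointing upwards, the new component
`ω` passes upwards either along the left-hand side of the crossing, over its south-western and then
over its north-western leg, or along the right-hand side, over its south-eastern and then over its
north-eastern leg. So `ω` crosses one leg of each of the two strands. The leg of the strand from
south-west to north-east is crossed from its right to its left, a negative crossing. The leg of the
strand from south-east to north-west is crossed from its left to its right, a positive crossing. -/

/-- The passage of `D` under `ω` next to the passage `a` through a classical crossing. The new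
crossings are named by `ν`. -/
def underOmega (ν : ℕ → Bool → ℕ) (a : Passage) : Passage :=
  underPass (ν a.label a.rising) (!a.rising)

/-- The passage of `ω` over `D` next to the passage `a` through a classical crossing. -/
def overOmega (ν : ℕ → Bool → ℕ) (a : Passage) : Passage :=
  overPass (ν a.label a.rising) (!a.rising)

/-- A passage of `D` together with the crossing with `ω` next to it. If `ω` is drawn along the left
side of a crossing, then it meets the rising strand before, and the other strand after that
crossing; if `ω` is drawn along the right side, it is the other way round. -/
def flank (left : ℕ → Bool) (ν : ℕ → Bool → ℕ) (a : Passage) : List Passage :=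
  if a.kind = .virt then [a]
  else if a.rising = left a.label then [underOmega ν a, a]
  else [a, underOmega ν a]

/-- Forget the crossings with names in `V`. -/
def erase (V : Finset ℕ) (w : List Passage) : List Passage :=
  w.filter fun a => decide (a.label ∉ V)

/-- `E` is a diagram `Ж(D) = D ∪ ω`, with `ω` as its last component. For each classical crossing of
`D`, the side on which `ω` is drawn is chosen (`left`), the over-crossing arcs of `ω` are connected
in an arbitrary order and in an arbitrary way, and all further crossings of `ω` with `D` and with
itself (named by `V`) are virtual. -/
def IsZh {n : ℕ} (D : Diagram n) (E : Diagram (n + 1)) : Prop :=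
  ∃ (left : ℕ → Bool) (ν : ℕ → Bool → ℕ) (V : Finset ℕ),
    (∀ l ∈ V, ∃ a ∈ E.word (Fin.last n), a.label = l ∧ a.kind = .virt) ∧
    (∀ i : Fin n, erase V (E.word i.castSucc) = (D.word i).flatMap (flank left ν)) ∧
    (erase V (E.word (Fin.last n))).Perm
      ((((List.finRange n).flatMap D.word).filter fun a => decide (a.kind ≠ .virt)).map
        (overOmega ν))

/-- The passages in `flank`. -/
theorem mem_flank (left : ℕ → Bool) (ν : ℕ → Bool → ℕ) (a c : Passage) :
    c ∈ flank left ν a ↔ c = a ∨ (a.kind ≠ .virt ∧ c = underOmega ν a) := by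
  unfold flank
  split_ifs with h1 h2
  · simp [h1]
  · simp [h1, or_comm]
  · simp [h1]

/-- Every diagram `D` has a diagram `Ж(D)`. -/
theorem exists_isZh {n : ℕ} (D : Diagram n) : ∃ E : Diagram (n + 1), IsZh D E := by
  classical
  set L := (List.finRange n).flatMap D.word with hL
  obtain ⟨M, hM⟩ : ∃ M, ∀ a ∈ L, a.label < M := by
    obtain ⟨M, hM⟩ := (L.toFinset.image Passage.label).exists_nat_subset_range
    refine ⟨M, fun a ha => Finset.mem_range.1 (hM (Finset.mem_image_of_mem _ ?_))⟩
    simpa using ha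
  let ν : ℕ → Bool → ℕ := fun l b => M + (2 * l + b.toNat)
  have hν : ∀ l b l' b', ν l b = ν l' b' → l = l' ∧ b = b' := by
    intro l b l' b' h
    simp only [ν] at h
    cases b <;> cases b' <;> simp at h ⊢ <;> omega
  let left : ℕ → Bool := fun _ => true
  let O : List Passage := (L.filter fun a => decide (a.kind ≠ .virt)).map (overOmega ν)
  let W : Fin (n + 1) → List Passage :=
    Fin.lastCases O fun i => (D.word i).flatMap (flank left ν)
  have hW : (List.finRange (n + 1)).flatMap W = L.flatMap (flank left ν) ++ O := by
    simp [List.finRange_succ_last, List.flatMap_map, W, hL, List.flatMap_assoc]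
  have hu : ∀ a b, underOmega ν a = underOmega ν b → a.label = b.label ∧ a.rising = b.rising :=
    fun a b h => hν _ _ _ _ (congrArg Passage.label h)
  have ho : ∀ a b, overOmega ν a = overOmega ν b → a.label = b.label ∧ a.rising = b.rising :=
    fun a b h => hν _ _ _ _ (congrArg Passage.label h)
  have hinj : ∀ a ∈ L, ∀ b ∈ L, a.label = b.label → a.rising = b.rising → a = b := by
    rintro a ha b hb h h'
    have := D.kind_eq a ha b hb h
    cases a; cases b; simp_all
  have hlt : ∀ a ∈ L, ∀ l b, a.label ≠ ν l b := fun a ha l b h => by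
    have := hM a ha
    simp only [ν] at h
    omega
  have hfl : ∀ a c, c ∈ flank left ν a ↔ c = a ∨ (a.kind ≠ .virt ∧ c = underOmega ν a) :=
    fun a c => mem_flank left ν a c
  have hmem : ∀ c, c ∈ L.flatMap (flank left ν) ++ O ↔
      c ∈ L ∨ ∃ a ∈ L, a.kind ≠ .virt ∧ (c = underOmega ν a ∨ c = overOmega ν a) := by
    intro c
    simp only [List.mem_append, List.mem_flatMap, hfl, O, List.mem_map, List.mem_filter,
      decide_eq_true_eq]
    constructor
    · rintro (⟨a, ha, rfl | ⟨h, rfl⟩⟩ | ⟨a, ⟨ha, h⟩, rfl⟩)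
      · exact .inl ha
      · exact .inr ⟨a, ha, h, .inl rfl⟩
      · exact .inr ⟨a, ha, h, .inr rfl⟩
    · rintro (h | ⟨a, ha, h, rfl | rfl⟩)
      · exact .inl ⟨c, h, .inl rfl⟩
      · exact .inl ⟨a, ha, .inr ⟨h, rfl⟩⟩
      · exact .inr ⟨a, ⟨ha, h⟩, rfl⟩
  have huo : ∀ a b, underOmega ν a ≠ overOmega ν b := by
    intro a b h
    have h1 := hν _ _ _ _ (congrArg Passage.label h)
    have h2 := congrArg Passage.rising h
    simp [underOmega, overOmega, underPass, overPass, h1.2] at h2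
  have hnd : (L.flatMap (flank left ν) ++ O).Nodup := by
    rw [List.nodup_append]
    refine ⟨?_, ?_, ?_⟩
    · rw [List.nodup_flatMap]
      refine ⟨fun a ha => ?_, ?_⟩
      · have : a ≠ underOmega ν a := fun h => hlt a ha _ _ (congrArg Passage.label h)
        unfold flank
        split_ifs <;> simp [this, this.symm]
      · refine List.Pairwise.imp_of_mem ?_ D.nodup
        intro a b ha hb hab c hc hc'
        rw [hfl] at hc hc'
        rcases hc with rfl | ⟨-, rfl⟩ <;> rcases hc' with h | ⟨-, h⟩
        · exact hab h
        · exact hlt _ ha _ _ (congrArg Passage.label h)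
        · exact hlt _ hb _ _ (congrArg Passage.label h.symm)
        · exact hab (hinj a ha b hb (hu _ _ h).1 (hu _ _ h).2)
    · refine List.Nodup.map_on ?_ (D.nodup.filter _)
      intro a ha b hb h
      exact hinj a (List.mem_filter.1 ha).1 b (List.mem_filter.1 hb).1 (ho _ _ h).1 (ho _ _ h).2
    · intro c hc d hd hcd
      subst hcd
      obtain ⟨b, hb, rfl⟩ := List.mem_map.1 hd
      obtain ⟨a, ha, hc⟩ := List.mem_flatMap.1 hc
      rw [hfl] at hc
      rcases hc with h | ⟨-, h⟩
      · exact hlt a ha _ _ (congrArg Passage.label h.symm)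
      · exact huo _ _ h.symm
  refine ⟨⟨W, hW ▸ hnd, ?_, ?_⟩, left, ν, ∅, by simp, ?_, ?_⟩
  · rw [hW]
    intro c hc
    rw [hmem] at hc ⊢
    rcases hc with h | ⟨a, ha, h, rfl | rfl⟩
    · exact .inl (D.mate_mem c h)
    · exact .inr ⟨a, ha, h, .inr (by simp [underOmega, overOmega, underPass, overPass, Passage.mate])⟩
    · exact .inr ⟨a, ha, h, .inl (by simp [underOmega, overOmega, underPass, overPass, Passage.mate])⟩
  · rw [hW]
    have key : ∀ c, (∃ a ∈ L, a.kind ≠ .virt ∧ (c = underOmega ν a ∨ c = overOmega ν a)) →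
        ∃ l b, c.label = ν l b ∧ c.kind = .ofSign !b := by
      rintro c ⟨a, -, -, rfl | rfl⟩ <;> exact ⟨a.label, a.rising, rfl, rfl⟩
    intro c hc d hd h
    rw [hmem] at hc hd
    rcases hc with hc | hc <;> rcases hd with hd | hd
    · exact D.kind_eq c hc d hd h
    · obtain ⟨l, b, h1, -⟩ := key d hd
      exact absurd (h.trans h1) (hlt c hc _ _)
    · obtain ⟨l, b, h1, -⟩ := key c hc
      exact absurd (h.symm.trans h1) (hlt d hd _ _)
    · obtain ⟨l, b, h1, h2⟩ := key c hc
      obtain ⟨l', b', h1', h2'⟩ := key d hd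
      obtain ⟨-, rfl⟩ := hν _ _ _ _ (h1.symm.trans (h.trans h1'))
      rw [h2, h2']
  · intro i
    simp [erase, W]
  · simp [erase, W, O, hL]

end VirtualLink

/-! A quandle is determined up to isomorphism by the homomorphisms out of it, and homomorphisms from
`FundamentalQuandle E` to `X` are the colourings of `E` by `X`: colours of the base points are
propagated along the components, and each classical crossing records the colour of its over-crossing
strand (`fundamentalQuandle_represents`). It therefore suffices to match colourings bijectively and
naturally in `X` (`Correspondence.represents`, `Theory.Represents.exists_iso`).

In `Ж(D)` the component `ω` never passes under a classical crossing, so it carries a single colour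
`w`. Each passage of `D` through a classical crossing is accompanied by a passage under `ω`, which
applies `w ◃⁻¹` on a rising strand and `w ◃` on the other one. A colouring of `Ж(D)` is thus an
element `w` together with a colouring of `D` twisted by these automorphisms. The side on which `ω`
runs only decides whether the over-crossing colour is read before or after the twist, which is a
change of variables; the way in which `ω` is closed up is invisible. Hence the colourings of `Ж(D)`
correspond to `twistedTheory D`, where no choices are left (`IsZh.correspondence`).

Twisted colourings are invariant under all moves (`Move.correspondence`). Virtual passages do not
change colours, which settles detours. Reidemeister moves are compared locally, with fixed colours
on the boundary: in a kink or a bigon the twists along each strand cancel, and in a triangle they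
are powers of one automorphism, so that the usual quandle identities remain. For the ωOCC move no
twist is needed: the colourings before and after it coincide (`OmegaOCC.correspondence`). -/

/-- A homomorphism of quandles commutes with the inverse operation. -/
theorem ShelfHom.map_invAct {Q X : Type} [Quandle Q] [Quandle X] (f : Q →◃ X) (x y : Q) :
    f (x ◃⁻¹ y) = f x ◃⁻¹ f y := by
  rw [← Rack.left_cancel (f x), ← f.map_act, Rack.act_invAct_eq, Rack.act_invAct_eq]

namespace VirtualLink

/-! ## Walking along words of passages -/

/-- Whether the passage is along the over-crossing strand of a classical crossing. -/
def Passage.isOver : Passage → Bool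
  | ⟨_, .pos, b⟩ => b
  | ⟨_, .neg, b⟩ => !b
  | ⟨_, .virt, _⟩ => false

section Walk

variable {X Y : Type} [Quandle X] [Quandle Y]

/-- The colour after a passage, given the colour before it and the colours `o` of the
over-crossing strands. The colours of all strands are moreover transported by `γ`. -/
def cross (γ : Bool → X → X) (o : ℕ → X) : Passage → X → X
  | ⟨_, .pos, true⟩, x => γ true x
  | ⟨l, .pos, false⟩, x => o l ◃ γ false x
  | ⟨l, .neg, true⟩, x => o l ◃⁻¹ γ true x
  | ⟨_, .neg, false⟩, x => γ false x
  | ⟨_, .virt, _⟩, x => x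

/-- The colour after a word of passages. -/
def run (γ : Bool → X → X) (o : ℕ → X) (w : List Passage) (x : X) : X :=
  w.foldl (fun x a => cross γ o a x) x

/-- A walk along a word which starts with the colour `x`, ends with the colour `y`, and meets the
colours `o` at the over-crossing passages. -/
def Walk (γ : Bool → X → X) (o : ℕ → X) : List Passage → X → X → Prop
  | [], x, y => x = y
  | a :: w, x, y => (a.isOver = true → o a.label = x) ∧ Walk γ o w (cross γ o a x) y

@[simp] theorem walk_nil (γ : Bool → X → X) (o : ℕ → X) (x y : X) :
    Walk γ o [] x y ↔ x = y := Iff.rfl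

@[simp] theorem walk_cons (γ : Bool → X → X) (o : ℕ → X) (a : Passage) (w : List Passage)
    (x y : X) : Walk γ o (a :: w) x y ↔
      (a.isOver = true → o a.label = x) ∧ Walk γ o w (cross γ o a x) y := Iff.rfl

@[simp] theorem run_nil (γ : Bool → X → X) (o : ℕ → X) (x : X) : run γ o [] x = x := rfl

@[simp] theorem run_cons (γ : Bool → X → X) (o : ℕ → X) (a : Passage) (w : List Passage) (x : X) :
    run γ o (a :: w) x = run γ o w (cross γ o a x) := rfl

theorem run_append (γ : Bool → X → X) (o : ℕ → X) (u w : List Passage) (x : X) :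
    run γ o (u ++ w) x = run γ o w (run γ o u x) := by
  simp [run]

theorem walk_append (γ : Bool → X → X) (o : ℕ → X) (u w : List Passage) (x y : X) :
    Walk γ o (u ++ w) x y ↔ ∃ z, Walk γ o u x z ∧ Walk γ o w z y := by
  induction u generalizing x with
  | nil => simp
  | cons a u ih => simp [ih, and_assoc]

theorem Walk.eq_run {γ : Bool → X → X} {o : ℕ → X} {w : List Passage} {x y : X}
    (h : Walk γ o w x y) : y = run γ o w x := by
  induction w generalizing x with
  | nil => exact h.symm
  | cons a w ih => exact ih h.2

theorem Walk.unique {γ : Bool → X → X} {o : ℕ → X} {w : List Passage} {x y z : X}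
    (h : Walk γ o w x y) (h' : Walk γ o w x z) : y = z :=
  h.eq_run.trans h'.eq_run.symm

/-- Replaces the recursion by one condition per position of the word, matching the indexing of
points and arcs of a diagram. -/
theorem walk_run_iff (γ : Bool → X → X) (o : ℕ → X) (w : List Passage) (x : X) :
    Walk γ o w x (run γ o w x) ↔
      ∀ p : Fin w.length, (w.get p).isOver = true → o (w.get p).label = run γ o (w.take p) x := by
  induction w generalizing x with
  | nil => simp
  | cons a w ih => simp [ih, Fin.forall_fin_succ]

theorem cross_virt (γ : Bool → X → X) (o : ℕ → X) {a : Passage} (h : a.kind = .virt) (x : X) :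
    cross γ o a x = x := by
  obtain ⟨l, k, b⟩ := a
  cases h
  rfl

theorem isOver_virt {a : Passage} (h : a.kind = .virt) : a.isOver = false := by
  obtain ⟨l, k, b⟩ := a
  cases h
  rfl

/-- Only virtual passages may be dropped, and these neither change the colour nor record one. -/
theorem walk_filter (γ : Bool → X → X) (o : ℕ → X) (p : Passage → Bool) {w : List Passage}
    (h : ∀ a ∈ w, p a = false → a.kind = .virt) (x y : X) :
    Walk γ o (w.filter p) x y ↔ Walk γ o w x y := by
  induction w generalizing x with
  | nil => rfl
  | cons a w ih =>
    have ih := ih fun b hb => h b (by simp [hb])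
    cases hp : p a
    · have hk := h a (by simp) hp
      simp [hp, ih, isOver_virt hk, cross_virt γ o hk]
    · simp [hp, ih]

theorem cross_congr (γ : Bool → X → X) {o o' : ℕ → X} {a : Passage}
    (h : a.kind ≠ .virt → o a.label = o' a.label) (x : X) : cross γ o a x = cross γ o' a x := by
  obtain ⟨l, _ | _ | _, _ | _⟩ := a <;> simp_all [cross]

theorem isOver_kind {a : Passage} (h : a.isOver = true) : a.kind ≠ .virt := by
  intro h'
  simp [isOver_virt h'] at h

theorem Walk.congr {γ : Bool → X → X} {o o' : ℕ → X} {w : List Passage}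
    (h : ∀ a ∈ w, a.kind ≠ .virt → o a.label = o' a.label) {x y : X} (hw : Walk γ o w x y) :
    Walk γ o' w x y := by
  induction w generalizing x with
  | nil => exact hw
  | cons a w ih =>
    refine ⟨fun h' => ?_, ?_⟩
    · rw [← h a (by simp) (isOver_kind h'), hw.1 h']
    · rw [← cross_congr γ (h a (by simp))]
      exact ih (fun b hb => h b (by simp [hb])) hw.2

theorem map_cross (f : X →◃ Y) {γ : Bool → X → X} {γ' : Bool → Y → Y}
    (hγ : ∀ b x, f (γ b x) = γ' b (f x)) (o : ℕ → X) (a : Passage) (x : X) :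
    f (cross γ o a x) = cross γ' (f ∘ o) a (f x) := by
  obtain ⟨l, _ | _ | _, _ | _⟩ := a <;> simp [cross, hγ, ShelfHom.map_invAct]

theorem map_run (f : X →◃ Y) {γ : Bool → X → X} {γ' : Bool → Y → Y}
    (hγ : ∀ b x, f (γ b x) = γ' b (f x)) (o : ℕ → X) (w : List Passage) (x : X) :
    f (run γ o w x) = run γ' (f ∘ o) w (f x) := by
  induction w generalizing x with
  | nil => rfl
  | cons a w ih => rw [run_cons, ih, map_cross f hγ, run_cons]

theorem Walk.map (f : X →◃ Y) {γ : Bool → X → X} {γ' : Bool → Y → Y}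
    (hγ : ∀ b x, f (γ b x) = γ' b (f x)) {o : ℕ → X} {w : List Passage} {x y : X}
    (h : Walk γ o w x y) : Walk γ' (f ∘ o) w (f x) (f y) := by
  induction w generalizing x with
  | nil => exact congrArg f h
  | cons a w ih =>
    refine ⟨fun h' => congrArg f (h.1 h'), ?_⟩
    rw [← map_cross f hγ]
    exact ih h.2

/-- The transport by the operation of a fixed element `w`: backwards on rising strands, forwards on
the other ones. -/
def gauge (w : X) (b : Bool) (x : X) : X := if b then w ◃⁻¹ x else w ◃ x

theorem map_gauge (f : X →◃ Y) (w : X) (b : Bool) (x : X) :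
    f (gauge w b x) = gauge (f w) b (f x) := by
  cases b <;> simp [gauge, ShelfHom.map_invAct]

end Walk

/-! ## Universal colourings -/

/-- The data of a colouring of a diagram with `N` components: the colour of a distinguished point,
the colours at the base points, and the colours of the over-crossing strands. -/
@[ext]
structure Coloring (N : ℕ) (X : Type) : Type where
  pt : X
  base : Fin N → X
  strand : ℕ → X

/-- The image of a colouring under a map. -/
def Coloring.map {N : ℕ} {X Y : Type} (f : X → Y) (c : Coloring N X) : Coloring N Y :=
  ⟨f c.pt, f ∘ c.base, f ∘ c.strand⟩

/-- A notion of admissible colouring by quandles which is compatible with homomorphisms. -/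
structure Theory (N : ℕ) : Type 1 where
  Valid : ∀ {X : Type} [Quandle X], Coloring N X → Prop
  map : ∀ {X Y : Type} [Quandle X] [Quandle Y] (f : X →◃ Y) (c : Coloring N X),
    Valid c → Valid (c.map f)

/-- Every admissible colouring is the image of `c` under a unique homomorphism. -/
def Theory.IsUniversal {N : ℕ} (T : Theory N) {Q : Type} [Quandle Q] (c : Coloring N Q) : Prop :=
  T.Valid c ∧ ∀ (X : Type) [Quandle X] (d : Coloring N X), T.Valid d →
    ∃! f : Q →◃ X, c.map f = d

/-- The quandle `Q` carries a universal colouring. -/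
def Theory.Represents {N : ℕ} (T : Theory N) (Q : Type) [Quandle Q] : Prop :=
  ∃ c : Coloring N Q, T.IsUniversal c

/-- Yoneda: each universal colouring is an image of the other, and uniqueness makes the two
homomorphisms mutually inverse. -/
theorem Theory.Represents.exists_iso {N : ℕ} {T : Theory N} {Q Q' : Type} [Quandle Q] [Quandle Q']
    (h : T.Represents Q) (h' : T.Represents Q') : ∃ f : Q →◃ Q', Function.Bijective f := by
  obtain ⟨c, hc, hcu⟩ := h
  obtain ⟨d, hd, hdu⟩ := h'
  obtain ⟨f, hf, -⟩ := hcu Q' d hd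
  obtain ⟨g, hg, -⟩ := hdu Q c hc
  have h1 : g.comp f = ShelfHom.id Q := by
    refine (hcu Q c hc).unique ?_ rfl
    exact (congrArg (Coloring.map g) hf).trans hg
  have h2 : f.comp g = ShelfHom.id Q' := by
    refine (hdu Q' d hd).unique ?_ rfl
    exact (congrArg (Coloring.map f) hg).trans hf
  exact ⟨f, Function.bijective_iff_has_inverse.2
    ⟨g, fun x => DFunLike.congr_fun h1 x, fun x => DFunLike.congr_fun h2 x⟩⟩

/-- A natural one-to-one correspondence between the admissible colourings of two theories. -/
structure Correspondence {N M : ℕ} (T : Theory N) (T' : Theory M) : Type 1 where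
  Rel : ∀ {X : Type} [Quandle X], Coloring N X → Coloring M X → Prop
  map : ∀ {X Y : Type} [Quandle X] [Quandle Y] (f : X →◃ Y) (c : Coloring N X) (d : Coloring M X),
    Rel c d → Rel (c.map f) (d.map f)
  right : ∀ {X : Type} [Quandle X] (c : Coloring N X), T.Valid c → ∃ d, T'.Valid d ∧ Rel c d
  left : ∀ {X : Type} [Quandle X] (d : Coloring M X), T'.Valid d → ∃ c, T.Valid c ∧ Rel c d
  right_unique : ∀ {X : Type} [Quandle X] (c : Coloring N X) (d d' : Coloring M X),
    T.Valid c → T'.Valid d → T'.Valid d' → Rel c d → Rel c d' → d = d'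
  left_unique : ∀ {X : Type} [Quandle X] (c c' : Coloring N X) (d : Coloring M X),
    T.Valid c → T.Valid c' → T'.Valid d → Rel c d → Rel c' d → c = c'

/-- The inverse correspondence. -/
def Correspondence.symm {N M : ℕ} {T : Theory N} {T' : Theory M} (S : Correspondence T T') :
    Correspondence T' T where
  Rel d c := S.Rel c d
  map f d c h := S.map f c d h
  right := S.left
  left := S.right
  right_unique d c c' hd hc hc' h h' := S.left_unique c c' d hc hc' hd h h'
  left_unique d d' c hd hd' hc h h' := S.right_unique c d d' hc hd hd' h h'

/-- The partner of a universal colouring is universal: naturality carries the relation along every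
homomorphism, and uniqueness of partners then identifies the images. -/
theorem Correspondence.represents {N M : ℕ} {T : Theory N} {T' : Theory M}
    (S : Correspondence T T') {Q : Type} [Quandle Q] (h : T.Represents Q) : T'.Represents Q := by
  obtain ⟨c, hc, hcu⟩ := h
  obtain ⟨d, hd, hcd⟩ := S.right c hc
  refine ⟨d, hd, fun X _ d' hd' => ?_⟩
  obtain ⟨c', hc', hcd'⟩ := S.left d' hd'
  obtain ⟨f, hf, hfu⟩ := hcu X c' hc'
  refine ⟨f, ?_, fun g hg => hfu g ?_⟩
  · have := S.map f c d hcd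
    rw [hf] at this
    exact S.right_unique c' _ _ hc' (T'.map f d hd) hd' this hcd'
  · have := S.map g c d hcd
    rw [hg] at this
    exact S.left_unique _ _ d' (T.map g c hc) hc' hd' this hcd'

theorem Correspondence.represents_iff {N M : ℕ} {T : Theory N} {T' : Theory M}
    (S : Correspondence T T') (Q : Type) [Quandle Q] : T.Represents Q ↔ T'.Represents Q :=
  ⟨S.represents, S.symm.represents⟩

/-- Theories with the same admissible colourings correspond to each other. -/
def Correspondence.ofIff {N : ℕ} {T T' : Theory N}
    (h : ∀ {X : Type} [Quandle X] (c : Coloring N X), T.Valid c ↔ T'.Valid c) :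
    Correspondence T T' where
  Rel c d := c = d
  map _ _ _ h := h ▸ rfl
  right c hc := ⟨c, (h c).1 hc, rfl⟩
  left c hc := ⟨c, (h c).2 hc, rfl⟩
  right_unique _ _ _ _ _ _ h h' := h.symm.trans h'
  left_unique _ _ _ _ _ _ h h' := h.trans h'.symm

/-! ## Colourings of diagrams -/

section Diagram

variable {n : ℕ}

/-- The crossing `l` occurs in the words, and it is classical. -/
def IsClassical (w : Fin n → List Passage) (l : ℕ) : Prop :=
  ∃ i, ∃ a ∈ w i, a.label = l ∧ a.kind ≠ .virt

/-- The quandle colourings of a diagram whose last component is distinguished. -/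
def plainTheory (E : Diagram (n + 1)) : Theory (n + 1) where
  Valid c := c.pt = c.base (Fin.last n) ∧
    (∀ i, Walk (fun _ x => x) c.strand (E.word i) (c.base i) (c.base i)) ∧
    ∀ l, ¬ IsClassical E.word l → c.strand l = c.pt
  map f _ h := ⟨congrArg f h.1, fun i => (h.2.1 i).map f fun _ _ => rfl,
    fun l hl => congrArg f (h.2.2 l hl)⟩

/-- The quandle colourings of a diagram, twisted by the operation of a distinguished colour. -/
def twistedTheory (D : Diagram n) : Theory n where
  Valid c := (∀ i, Walk (gauge c.pt) c.strand (D.word i) (c.base i) (c.base i)) ∧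
    ∀ l, ¬ IsClassical D.word l → c.strand l = c.pt
  map f _ h := ⟨fun i => (h.1 i).map f (map_gauge f _), fun l hl => congrArg f (h.2 l hl)⟩

/-! ### Passages and classical crossings of a diagram. -/

theorem Diagram.mem_passages (D : Diagram n) {a : Passage} :
    a ∈ (List.finRange n).flatMap D.word ↔ ∃ i, a ∈ D.word i := by
  simp

theorem Diagram.nodup_word (D : Diagram n) (i : Fin n) : (D.word i).Nodup :=
  (List.nodup_flatMap.1 D.nodup).1 i (List.mem_finRange i)

theorem Diagram.index_eq (D : Diagram n) {a : Passage} {i j : Fin n} (hi : a ∈ D.word i)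
    (hj : a ∈ D.word j) : i = j := by
  by_contra h
  have : Std.Symm (Function.onFun List.Disjoint D.word) := ⟨fun _ _ h => h.symm⟩
  exact (List.nodup_flatMap.1 D.nodup).2.forall (List.mem_finRange i) (List.mem_finRange j) h hi hj

theorem Diagram.kind_eq_of_mem (D : Diagram n) {a b : Passage} {i j : Fin n} (hi : a ∈ D.word i)
    (hj : b ∈ D.word j) (h : a.label = b.label) : a.kind = b.kind :=
  D.kind_eq a (D.mem_passages.2 ⟨i, hi⟩) b (D.mem_passages.2 ⟨j, hj⟩) h

theorem Diagram.exists_mate (D : Diagram n) {a : Passage} {i : Fin n} (hi : a ∈ D.word i) :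
    ∃ j, a.mate ∈ D.word j :=
  D.mem_passages.1 (D.mate_mem a (D.mem_passages.2 ⟨i, hi⟩))

theorem eq_overPass_or_underPass {a : Passage} (h : a.kind ≠ .virt) :
    ∃ s, a = overPass a.label s ∨ a = underPass a.label s := by
  obtain ⟨l, _ | _ | _, _ | _⟩ := a <;> simp_all [overPass, underPass, Kind.ofSign]

theorem mate_underPass (l : ℕ) (s : Bool) : (underPass l s).mate = overPass l s := by
  simp [underPass, overPass, Passage.mate]

theorem isOver_iff {a : Passage} : a.isOver = true ↔ ∃ s, a = overPass a.label s := by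
  obtain ⟨l, _ | _ | _, _ | _⟩ := a <;> simp [overPass, Kind.ofSign, Passage.isOver]

theorem overPass_kind (l : ℕ) (s : Bool) : (overPass l s).kind ≠ .virt := by
  cases s <;> simp [overPass, Kind.ofSign]

theorem Diagram.isClassical_iff (D : Diagram n) (l : ℕ) :
    IsClassical D.word l ↔ ∃ i s, overPass l s ∈ D.word i := by
  constructor
  · rintro ⟨i, a, ha, rfl, hk⟩
    obtain ⟨s, h | h⟩ := eq_overPass_or_underPass hk
    · exact ⟨i, s, h ▸ ha⟩
    · obtain ⟨j, hj⟩ := D.exists_mate ha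
      rw [h, mate_underPass] at hj
      exact ⟨j, s, hj⟩
  · rintro ⟨i, s, h⟩
    exact ⟨i, _, h, rfl, overPass_kind l s⟩

end Diagram

end VirtualLink

/-! ## Homomorphisms from presented quandles -/

section Lift

variable {X : Type} {R : QuandleTerm X → QuandleTerm X → Prop} {Z : Type} [Quandle Z]

/-- The value of a quandle expression. -/
def QuandleTerm.eval (g : X → Z) : QuandleTerm X → Z
  | .of x => g x
  | .op s t => t.eval g ◃ s.eval g
  | .inv s t => t.eval g ◃⁻¹ s.eval g

theorem QuandleTerm.Congr.eval_eq {g : X → Z} (hg : ∀ s t, R s t → s.eval g = t.eval g)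
    {s t : QuandleTerm X} (h : QuandleTerm.Congr R s t) : s.eval g = t.eval g := by
  induction h with
  | rel h => exact hg _ _ h
  | refl s => rfl
  | symm _ ih => exact ih.symm
  | trans _ _ ih ih' => exact ih.trans ih'
  | op _ _ ih ih' => simp only [QuandleTerm.eval, ih, ih']
  | inv _ _ ih ih' => simp only [QuandleTerm.eval, ih, ih']
  | idem s => exact Quandle.fix
  | inv_op s t => exact Rack.invAct_act_eq _ _
  | op_inv s t => exact Rack.act_invAct_eq _ _
  | distrib s t u => exact Shelf.self_distrib

/-- The class of a quandle expression. -/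
def PresentedQuandle.mk (R : QuandleTerm X → QuandleTerm X → Prop) (s : QuandleTerm X) :
    PresentedQuandle R := Quotient.mk (QuandleTerm.setoid R) s

theorem PresentedQuandle.mk_eq {s t : QuandleTerm X} (h : R s t) :
    PresentedQuandle.mk R s = PresentedQuandle.mk R t :=
  Quotient.sound (s := QuandleTerm.setoid R) (.rel h)

/-- The homomorphism given by the images of the generators. -/
def PresentedQuandle.lift (g : X → Z) (hg : ∀ s t, R s t → s.eval g = t.eval g) :
    PresentedQuandle R →◃ Z where
  toFun := Quotient.lift (s := QuandleTerm.setoid R) (QuandleTerm.eval g) fun _ _ h => h.eval_eq hg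
  map_act' := by
    rintro ⟨x⟩ ⟨y⟩
    rfl

theorem PresentedQuandle.map_mk (f : PresentedQuandle R →◃ Z) (s : QuandleTerm X) :
    f (.mk R s) = s.eval fun x => f (.mk R (.of x)) := by
  induction s with
  | of x => rfl
  | op s t ih ih' =>
    rw [QuandleTerm.eval, ← ih, ← ih', ← f.map_act]
    rfl
  | inv s t ih ih' =>
    rw [QuandleTerm.eval, ← ih, ← ih', ← f.map_invAct]
    rfl

theorem PresentedQuandle.hom_ext {f g : PresentedQuandle R →◃ Z}
    (h : ∀ x, f (.mk R (.of x)) = g (.mk R (.of x))) : f = g := by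
  refine DFunLike.ext _ _ ?_
  rintro ⟨s⟩
  exact (map_mk f s).trans ((congrArg (QuandleTerm.eval · s) (funext h)).trans (map_mk g s).symm)

end Lift

namespace VirtualLink

/-! ## The universal colouring by the fundamental quandle -/

section Fundamental

variable {n : ℕ}

/-- The element of the fundamental quandle given by the arc through a point. -/
def Diagram.elt (E : Diagram n) (x : E.Point) : FundamentalQuandle E :=
  PresentedQuandle.mk _ (E.gen x)

theorem Diagram.elt_eq_of_step (E : Diagram n) {x y : E.Point} (h : E.Step x y) :
    E.elt x = E.elt y :=
  congrArg (fun a => PresentedQuandle.mk E.CrossingRel (.of a)) (Quot.sound h)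

theorem eq_of_isOver {a b : Passage} (ha : a.isOver = true) (hb : b.isOver = true)
    (hl : a.label = b.label) (hk : a.kind = b.kind) : a = b := by
  obtain ⟨l, _ | _ | _, _ | _⟩ := a <;> obtain ⟨l', _ | _ | _, _ | _⟩ := b <;>
    simp_all [Passage.isOver]

theorem isUnder_of_isOver {a : Passage} (ha : a.isOver = true) : a.isUnder = false := by
  obtain ⟨l, _ | _ | _, _ | _⟩ := a <;> simp_all [Passage.isOver, Passage.isUnder]

theorem Diagram.position_eq (E : Diagram n) {i j : Fin n} {p : Fin (E.word i).length}
    {q : Fin (E.word j).length} (h : (E.word i).get p = (E.word j).get q) :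
    (⟨i, p.castSucc⟩ : E.Point) = ⟨j, q.castSucc⟩ := by
  obtain rfl : i = j := E.index_eq (List.get_mem _ p) (h ▸ List.get_mem _ q)
  obtain rfl : p = q := (E.nodup_word i).injective_get h
  rfl

open Classical in
/-- The colours of the over-crossing strands of a diagram in its fundamental quandle. -/
noncomputable def Diagram.overElt (E : Diagram (n + 1)) (l : ℕ) : FundamentalQuandle E :=
  if h : ∃ x : (i : Fin (n + 1)) × Fin (E.word i).length,
      ((E.word x.1).get x.2).isOver = true ∧ ((E.word x.1).get x.2).label = l then
    E.elt ⟨h.choose.1, h.choose.2.castSucc⟩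
  else E.elt ⟨Fin.last n, 0⟩

/-- The choice in `overElt` is harmless: the label determines the kind, the kind determines the
over-crossing passage, and no passage is repeated. -/
theorem Diagram.overElt_label (E : Diagram (n + 1)) {i : Fin (n + 1)} {p : Fin (E.word i).length}
    (h : ((E.word i).get p).isOver = true) :
    E.overElt ((E.word i).get p).label = E.elt ⟨i, p.castSucc⟩ := by
  have hx : ∃ x : (j : Fin (n + 1)) × Fin (E.word j).length,
      ((E.word x.1).get x.2).isOver = true ∧
        ((E.word x.1).get x.2).label = ((E.word i).get p).label := ⟨⟨i, p⟩, h, rfl⟩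
  rw [Diagram.overElt, dif_pos hx]
  have := hx.choose_spec
  refine congrArg E.elt (E.position_eq (eq_of_isOver this.1 h this.2 ?_))
  exact E.kind_eq_of_mem (List.get_mem _ _) (List.get_mem _ _) this.2

theorem Diagram.overElt_not_isClassical (E : Diagram (n + 1)) {l : ℕ}
    (h : ¬ IsClassical E.word l) : E.overElt l = E.elt ⟨Fin.last n, 0⟩ := by
  rw [Diagram.overElt, dif_neg]
  rintro ⟨⟨i, p⟩, hp, hl⟩
  exact h ⟨i, _, List.get_mem _ p, hl, isOver_kind hp⟩

/-- The presentation rewritten as a propagation rule: under-crossings use the crossing relations,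
all other passages stay on the same arc. -/
theorem Diagram.elt_succ (E : Diagram (n + 1)) (i : Fin (n + 1)) (p : Fin (E.word i).length) :
    E.elt ⟨i, p.succ⟩ = cross (fun _ x => x) E.overElt ((E.word i).get p) (E.elt ⟨i, p.castSucc⟩) := by
  by_cases hu : ((E.word i).get p).isUnder = true
  · obtain ⟨l, s, hs⟩ : ∃ l s, (E.word i).get p = underPass l s := by
      revert hu
      obtain ⟨l, _ | _ | _, _ | _⟩ := (E.word i).get p <;>
        simp [Passage.isUnder, underPass, Kind.ofSign]
    obtain ⟨j, hj⟩ := E.exists_mate (List.get_mem (E.word i) p)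
    rw [hs, mate_underPass] at hj
    obtain ⟨q, hq⟩ := List.get_of_mem hj
    have ho : E.overElt l = E.elt ⟨j, q.castSucc⟩ := by
      rw [← E.overElt_label (i := j) (p := q), hq]
      · rfl
      · rw [hq]; exact isOver_iff.2 ⟨s, rfl⟩
    rw [hs]
    cases s
    -- The negative relation reads outgoing * over = incoming, so the over-crossing element is first
    -- applied to both sides.
    · refine ((Rack.left_cancel (E.elt ⟨j, q.castSucc⟩)).1 ?_)
      simp only [cross, underPass, Kind.ofSign, Bool.not_false, if_false, ho,
        Rack.act_invAct_eq, reduceCtorEq]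
      exact PresentedQuandle.mk_eq (.neg l j i q p hq hs)
    · simp only [cross, underPass, Kind.ofSign, Bool.not_true, if_true, ho]
      exact (PresentedQuandle.mk_eq (.pos l j i q p hq hs)).symm
  · rw [Bool.not_eq_true] at hu
    rw [← E.elt_eq_of_step (.pass i p hu)]
    revert hu
    obtain ⟨l, _ | _ | _, _ | _⟩ := (E.word i).get p <;>
        simp [Passage.isUnder, cross]

theorem Diagram.elt_eq_run (E : Diagram (n + 1)) (i : Fin (n + 1))
    (p : Fin ((E.word i).length + 1)) :
    E.elt ⟨i, p⟩ = run (fun _ x => x) E.overElt ((E.word i).take p) (E.elt ⟨i, 0⟩) := by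
  induction p using Fin.induction with
  | zero => simp
  | succ p ih =>
    rw [E.elt_succ, ih]
    simp only [Fin.val_succ, Fin.val_castSucc, List.get_eq_getElem]
    rw [List.take_succ_eq_append_getElem p.isLt, run_append]
    rfl

/-- The colouring of a diagram by its fundamental quandle. -/
noncomputable def Diagram.canonicalColoring (E : Diagram (n + 1)) :
    Coloring (n + 1) (FundamentalQuandle E) :=
  ⟨E.elt ⟨Fin.last n, 0⟩, fun i => E.elt ⟨i, 0⟩, E.overElt⟩

theorem Diagram.canonicalColoring_valid (E : Diagram (n + 1)) :
    (plainTheory E).Valid E.canonicalColoring := by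
  refine ⟨rfl, fun i => ?_, fun l hl => E.overElt_not_isClassical hl⟩
  have h : E.elt ⟨i, 0⟩ = run (fun _ x => x) E.overElt (E.word i) (E.elt ⟨i, 0⟩) := by
    conv_lhs => rw [E.elt_eq_of_step (.close i), E.elt_eq_run]
    simp
  have h' : Walk (fun _ x => x) E.overElt (E.word i) (E.elt ⟨i, 0⟩)
      (run (fun _ x => x) E.overElt (E.word i) (E.elt ⟨i, 0⟩)) :=
    (walk_run_iff _ _ _ _).2 fun p hp => by
      rw [E.overElt_label hp, E.elt_eq_run]
      rfl
  rw [← h] at h'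
  exact h'

/-- Propagated colours are constant on arcs and satisfy the crossing relations, so they define a
homomorphism. It is unique because the colour of every arc is computed from the base points and the
over-crossing strands. -/
theorem fundamentalQuandle_represents (E : Diagram (n + 1)) :
    (plainTheory E).Represents (FundamentalQuandle E) := by
  refine ⟨E.canonicalColoring, E.canonicalColoring_valid, fun X _ d hd => ?_⟩
  obtain ⟨hpt, hw, hs⟩ := hd
  have hov : ∀ i (p : Fin (E.word i).length), ((E.word i).get p).isOver = true →
      d.strand ((E.word i).get p).label =
        run (fun _ x => x) d.strand ((E.word i).take p) (d.base i) := by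
    intro i
    rw [← walk_run_iff, ← (hw i).eq_run]
    exact hw i
  -- The colour at a point, obtained by walking there from the base point of its component.
  let col : E.Point → X := fun x =>
    run (fun _ x => x) d.strand ((E.word x.1).take x.2) (d.base x.1)
  have hsucc : ∀ i (p : Fin (E.word i).length), col ⟨i, p.succ⟩ =
      cross (fun _ x => x) d.strand ((E.word i).get p) (col ⟨i, p.castSucc⟩) := by
    intro i p
    simp only [col, Fin.val_succ, Fin.val_castSucc, List.get_eq_getElem]
    rw [List.take_succ_eq_append_getElem p.isLt, run_append]
    rfl
  have hstep : ∀ x y, E.Step x y → col x = col y := by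
    rintro _ _ (⟨i⟩ | ⟨i, p, hp⟩)
    · simp only [col, Fin.val_zero, List.take_zero, run_nil, Fin.val_last, List.take_length]
      exact (hw i).eq_run
    · rw [hsucc]
      revert hp
      obtain ⟨l, _ | _ | _, _ | _⟩ := (E.word i).get p <;> simp [Passage.isUnder, cross]
  let g : E.Arc → X := Quot.lift col hstep
  have hg : ∀ s t, E.CrossingRel s t → s.eval g = t.eval g := by
    rintro _ _ (⟨l, i, j, p, q, hp, hq⟩ | ⟨l, i, j, p, q, hp, hq⟩)
    · have h1 := hov i p (hp ▸ rfl)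
      have h2 := hsucc j q
      rw [hp] at h1
      rw [hq] at h2
      change col ⟨i, p.castSucc⟩ ◃ col ⟨j, q.castSucc⟩ = col ⟨j, q.succ⟩
      rw [h2]
      change _ = d.strand l ◃ _
      rw [show d.strand l = _ from h1]
      rfl
    · have h1 := hov i p (hp ▸ rfl)
      have h2 := hsucc j q
      rw [hp] at h1
      rw [hq] at h2
      change col ⟨i, p.castSucc⟩ ◃ col ⟨j, q.succ⟩ = col ⟨j, q.castSucc⟩
      rw [h2]
      change _ ◃ (d.strand l ◃⁻¹ _) = _
      rw [show d.strand l = col ⟨i, p.castSucc⟩ from h1, Rack.act_invAct_eq]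
  have hval : ∀ (f : FundamentalQuandle E →◃ X) (x : E.Point),
      E.canonicalColoring.map f = d → f (E.elt x) = col x := by
    rintro f ⟨i, p⟩ rfl
    rw [E.elt_eq_run, map_run f (γ' := fun _ x => x) (fun _ _ => rfl)]
    rfl
  have hlift : ∀ x, PresentedQuandle.lift g hg (E.elt x) = col x := fun _ => rfl
  refine ⟨PresentedQuandle.lift g hg, ?_, fun f hf => ?_⟩
  · refine Coloring.ext ?_ (funext fun i => ?_) (funext fun l => ?_)
    · exact hpt.symm
    · rfl
    · by_cases hl : IsClassical E.word l
      · obtain ⟨i, s, hi⟩ := (E.isClassical_iff l).1 hl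
        obtain ⟨p, hp⟩ := List.get_of_mem hi
        have hp' : ((E.word i).get p).isOver = true := hp ▸ isOver_iff.2 ⟨s, rfl⟩
        have hpl : ((E.word i).get p).label = l := hp ▸ rfl
        have h1 := hov i p hp'
        have h2 := E.overElt_label hp'
        rw [hpl] at h1 h2
        change PresentedQuandle.lift g hg (E.overElt l) = _
        rw [h1, h2]
        rfl
      · change PresentedQuandle.lift g hg (E.overElt l) = _
        rw [E.overElt_not_isClassical hl, hs l hl, hpt]
        rfl
  · refine PresentedQuandle.hom_ext ?_
    rintro ⟨x⟩
    exact (hval f x hf).trans (hlift x).symm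

end Fundamental

/-! ## Colourings of `Ж(D)` -/

section Gauge

variable {X : Type} [Quandle X]

/-! ### The twist by `w` is an automorphism. -/

theorem gauge_gauge_not (w : X) (b : Bool) (x : X) : gauge w b (gauge w (!b) x) = x := by
  cases b <;> simp [gauge]

theorem gauge_not_gauge (w : X) (b : Bool) (x : X) : gauge w (!b) (gauge w b x) = x := by
  cases b <;> simp [gauge]

theorem invAct_act (w x y : X) : w ◃⁻¹ (x ◃ y) = (w ◃⁻¹ x) ◃ (w ◃⁻¹ y) := by
  rw [← Rack.left_cancel w, Rack.act_invAct_eq, Shelf.self_distrib, Rack.act_invAct_eq,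
    Rack.act_invAct_eq]

theorem gauge_act (w : X) (b : Bool) (x y : X) :
    gauge w b (x ◃ y) = gauge w b x ◃ gauge w b y := by
  cases b
  · exact Shelf.self_distrib
  · exact invAct_act w x y

theorem gauge_invAct (w : X) (b : Bool) (x y : X) :
    gauge w b (x ◃⁻¹ y) = gauge w b x ◃⁻¹ gauge w b y := by
  rw [← Rack.left_cancel (gauge w b x), ← gauge_act, Rack.act_invAct_eq, Rack.act_invAct_eq]

/-- The colour of the over-crossing strand at a crossing of sign `s`, depending on whether it is
measured before or behind the crossing with `ω`. -/
def shift (w : X) (left : ℕ → Bool) (s : Bool) (l : ℕ) (x : X) : X :=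
  if s = left l then gauge w s x else x

theorem exists_kind {a : Passage} (h : a.kind ≠ .virt) : ∃ s, a.kind = .ofSign s := by
  obtain ⟨l, _ | _ | _, b⟩ := a
  · exact ⟨true, rfl⟩
  · exact ⟨false, rfl⟩
  · exact absurd rfl h

theorem ofSign_ne_virt (s : Bool) : Kind.ofSign s ≠ .virt := by
  cases s <;> simp [Kind.ofSign]

theorem ofSign_inj {s t : Bool} (h : Kind.ofSign s = .ofSign t) : s = t := by
  cases s <;> cases t <;> simp_all [Kind.ofSign]

/-- In `cross`, the twist precedes an under-crossing passage and follows an over-crossing one, as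
for `ω` on the right of a positive or on the left of a negative crossing. For `ω` on the other side,
self-distributivity moves the twist past the crossing, at the price of twisting the over-crossing
colour; this is `shift`. -/
theorem walk_flank (left : ℕ → Bool) (ν : ℕ → Bool → ℕ) (w : X) {o o' : ℕ → X} {a : Passage}
    (hν : a.kind ≠ .virt → o' (ν a.label a.rising) = w)
    (hs : ∀ s, a.kind = .ofSign s → o' a.label = shift w left s a.label (o a.label)) (x y : X) :
    Walk (fun _ x => x) o' (flank left ν a) x y ↔ Walk (gauge w) o [a] x y := by
  obtain ⟨l, k, b⟩ := a
  cases k with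
  | virt => simp [flank, Passage.isOver, cross]
  | pos =>
    have hs := hs true rfl
    have hν := hν (by simp)
    cases hl : left l <;> cases b <;>
      simp_all [flank, underOmega, underPass, Passage.isOver, cross, Kind.ofSign, shift, gauge]
    · rw [Shelf.self_distrib, Rack.act_invAct_eq]
    · rintro rfl
      rw [Rack.left_cancel_inv]
  | neg =>
    have hs := hs false rfl
    have hν := hν (by simp)
    cases hl : left l <;> cases b <;>
      simp_all [flank, underOmega, underPass, Passage.isOver, cross, Kind.ofSign, shift, gauge]
    · rintro rfl
      rw [Rack.left_cancel]
    · have := gauge_invAct w true (w ◃ o l) x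
      simp only [gauge, if_true, Rack.invAct_act_eq] at this
      rw [this]

theorem walk_flatMap_flank (left : ℕ → Bool) (ν : ℕ → Bool → ℕ) (w : X) {o o' : ℕ → X}
    {u : List Passage} (hν : ∀ a ∈ u, a.kind ≠ .virt → o' (ν a.label a.rising) = w)
    (hs : ∀ a ∈ u, ∀ s, a.kind = .ofSign s → o' a.label = shift w left s a.label (o a.label))
    (x y : X) : Walk (fun _ x => x) o' (u.flatMap (flank left ν)) x y ↔ Walk (gauge w) o u x y := by
  induction u generalizing x with
  | nil => rfl
  | cons a u ih =>
    rw [List.flatMap_cons, walk_append, ← List.singleton_append, walk_append]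
    refine exists_congr fun z => and_congr ?_ ?_
    · exact walk_flank left ν w (hν a (by simp)) (hs a (by simp)) x z
    · exact ih (fun b hb => hν b (by simp [hb])) (fun b hb => hs b (by simp [hb])) z

theorem walk_over_iff (o : ℕ → X) {u : List Passage} (hu : ∀ a ∈ u, a.isUnder = false) (x y : X) :
    Walk (fun _ x => x) o u x y ↔ x = y ∧ ∀ a ∈ u, a.isOver = true → o a.label = x := by
  induction u with
  | nil => simp
  | cons a u ih =>
    have : cross (fun _ x => x) o a x = x := by
      have := hu a (by simp)
      obtain ⟨l, _ | _ | _, _ | _⟩ := a <;> simp_all [Passage.isUnder, cross]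
    rw [walk_cons, this, ih fun b hb => hu b (by simp [hb])]
    simp only [List.mem_cons, forall_eq_or_imp]
    tauto

end Gauge

-- A label determines the sign of its crossing, so a prescription depending on label and sign gives
-- a function of the label alone. The remaining labels receive the default value required by
-- `Valid`.
open Classical in
theorem Diagram.exists_strand {n : ℕ} {X : Type} (D : Diagram n) (F : ℕ → Bool → X) (w : X) :
    ∃ o : ℕ → X, (∀ i, ∀ a ∈ D.word i, ∀ s, a.kind = .ofSign s → o a.label = F a.label s) ∧
      ∀ l, ¬ IsClassical D.word l → o l = w := by
  let P : ℕ → Bool → Prop := fun l s => ∃ i, ∃ a ∈ D.word i, a.label = l ∧ a.kind = .ofSign s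
  refine ⟨fun l => if h : ∃ s, P l s then F l h.choose else w, ?_, ?_⟩
  · intro i a ha s hs
    have h : ∃ s, P a.label s := ⟨s, i, a, ha, rfl, hs⟩
    obtain ⟨j, b, hb, hl, hk⟩ := h.choose_spec
    have := ofSign_inj ((hk.symm.trans (D.kind_eq_of_mem hb ha hl)).trans hs)
    simp only [h, dif_pos]
    rw [this]
  · intro l hl
    refine dif_neg ?_
    rintro ⟨s, i, a, ha, h, hk⟩
    exact hl ⟨i, a, ha, h, hk ▸ ofSign_ne_virt s⟩

theorem overOmega_isOver (ν : ℕ → Bool → ℕ) (a : Passage) : (overOmega ν a).isOver = true :=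
  isOver_iff.2 ⟨_, rfl⟩

theorem underOmega_not_isOver (ν : ℕ → Bool → ℕ) (a : Passage) :
    (underOmega ν a).isOver = false := by
  obtain ⟨l, k, b⟩ := a
  cases b <;> rfl

/-- The colourings of `Ж(D)` correspond to the twisted colourings of `D`. -/
theorem IsZh.correspondence {n : ℕ} {D : Diagram n} {E : Diagram (n + 1)} (h : IsZh D E) :
    Nonempty (Correspondence (twistedTheory D) (plainTheory E)) := by
  obtain ⟨left, ν, V, hV, hword, hω⟩ := h
  -- Kinds depend only on labels, and every label in `V` belongs to a virtual passage of `ω`;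
  -- erasing `V` loses no classical passage.
  have virt : ∀ i, ∀ a ∈ E.word i, decide (a.label ∉ V) = false → a.kind = .virt := by
    intro i a ha hl
    obtain ⟨b, hb, hbl, hbk⟩ := hV a.label (by simpa using hl)
    rw [E.kind_eq_of_mem ha hb hbl.symm, hbk]
  have mem_flank' : ∀ i, ∀ a ∈ D.word i, ∀ c ∈ flank left ν a, c ∈ E.word i.castSucc := by
    intro i a ha c hc
    have : c ∈ erase V (E.word i.castSucc) := hword i ▸ List.mem_flatMap.2 ⟨a, ha, hc⟩
    exact (List.mem_filter.1 this).1
  have mem_self : ∀ i, ∀ a ∈ D.word i, a ∈ E.word i.castSucc := fun i a ha =>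
    mem_flank' i a ha a ((mem_flank _ _ _ _).2 (.inl rfl))
  have mem_omega : ∀ i, ∀ a ∈ D.word i, a.kind ≠ .virt → overOmega ν a ∈ E.word (Fin.last n) := by
    intro i a ha hk
    have : overOmega ν a ∈ erase V (E.word (Fin.last n)) := by
      rw [hω.mem_iff]
      refine List.mem_map_of_mem (List.mem_filter.2 ⟨D.mem_passages.2 ⟨i, ha⟩, by simpa using hk⟩)
    exact (List.mem_filter.1 this).1
  have omega_mem : ∀ a ∈ E.word (Fin.last n), a.kind ≠ .virt →
      ∃ i, ∃ b ∈ D.word i, b.kind ≠ .virt ∧ a = overOmega ν b := by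
    intro a ha hk
    have : a ∈ erase V (E.word (Fin.last n)) :=
      List.mem_filter.2 ⟨ha, by_contra fun h => hk (virt _ a ha (by simpa using h))⟩
    rw [hω.mem_iff] at this
    obtain ⟨b, hb, rfl⟩ := List.mem_map.1 this
    obtain ⟨hb, hb'⟩ := List.mem_filter.1 hb
    obtain ⟨i, hi⟩ := D.mem_passages.1 hb
    exact ⟨i, b, hi, by simpa using hb', rfl⟩
  have over_mem : ∀ i : Fin n, ∀ a ∈ E.word i.castSucc, a.isOver = true → a ∈ D.word i := by
    intro i a ha hk
    have : a ∈ erase V (E.word i.castSucc) :=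
      List.mem_filter.2 ⟨ha, by_contra fun h => isOver_kind hk (virt _ a ha (by simpa using h))⟩
    rw [hword] at this
    obtain ⟨b, hb, hab⟩ := List.mem_flatMap.1 this
    obtain rfl | ⟨-, rfl⟩ := (mem_flank _ _ _ _).1 hab
    · exact hb
    · simp [underOmega_not_isOver] at hk
  -- The names of the crossings with `ω` are new. Otherwise an over-crossing passage of a component
  -- of `D` would coincide with one of `ω`, and passages of `E` do not repeat.
  have not_classical : ∀ i, ∀ a ∈ D.word i, a.kind ≠ .virt →
      ¬ IsClassical D.word (ν a.label a.rising) := by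
    intro i a ha hk hcl
    obtain ⟨j, s, hj⟩ := (D.isClassical_iff _).1 hcl
    have h1 := mem_self j _ hj
    have h2 := mem_omega i a ha hk
    have h3 := ofSign_inj (E.kind_eq_of_mem h1 h2 rfl)
    have h4 : overPass (ν a.label a.rising) s = overOmega ν a := by rw [h3]; rfl
    have h5 := E.index_eq h1 (h4 ▸ h2)
    exact absurd h5 (Fin.castSucc_lt_last j).ne
  have classical_of : ∀ l, IsClassical D.word l → IsClassical E.word l := by
    rintro l ⟨i, a, ha, h⟩
    exact ⟨_, a, mem_self i a ha, h⟩
  have omega_under : ∀ a ∈ E.word (Fin.last n), a.isUnder = false := by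
    intro a ha
    by_cases hk : a.kind = .virt
    · obtain ⟨l, k, b⟩ := a
      cases hk
      rfl
    · obtain ⟨i, b, -, -, rfl⟩ := omega_mem a ha hk
      exact isUnder_of_isOver (overOmega_isOver ν b)
  have walk_omega : ∀ {X : Type} [Quandle X] (o : ℕ → X) (x : X),
      Walk (fun _ x => x) o (E.word (Fin.last n)) x x ↔
        ∀ i, ∀ a ∈ D.word i, a.kind ≠ .virt → o (ν a.label a.rising) = x := by
    intro X _ o x
    rw [walk_over_iff o omega_under]
    constructor
    · rintro ⟨-, h⟩ i a ha hk
      exact h _ (mem_omega i a ha hk) (overOmega_isOver ν a)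
    · refine fun h => ⟨rfl, fun a ha hk => ?_⟩
      obtain ⟨i, b, hb, hbk, rfl⟩ := omega_mem a ha (isOver_kind hk)
      exact h i b hb hbk
  have walk_word : ∀ {X : Type} [Quandle X] (o : ℕ → X) (i : Fin n) (x : X),
      Walk (fun _ x => x) o (E.word i.castSucc) x x ↔
        Walk (fun _ x => x) o ((D.word i).flatMap (flank left ν)) x x := by
    intro X _ o i x
    rw [← hword, erase, walk_filter _ _ _ (virt i.castSucc)]
  refine ⟨{
    Rel := fun c d => c.pt = d.pt ∧ (∀ i, c.base i = d.base i.castSucc) ∧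
      ∀ i, ∀ a ∈ D.word i, ∀ s, a.kind = .ofSign s →
        d.strand a.label = shift c.pt left s a.label (c.strand a.label)
    map := ?_, right := ?_, left := ?_, right_unique := ?_, left_unique := ?_ }⟩
  · rintro X Y _ _ f c d ⟨h1, h2, h3⟩
    refine ⟨congrArg f h1, fun i => congrArg f (h2 i), fun i a ha s hs => ?_⟩
    refine (congrArg f (h3 i a ha s hs)).trans ?_
    unfold shift
    split_ifs
    · exact map_gauge f _ _ _
    · rfl
  · rintro X _ ⟨w, base, o⟩ ⟨hwalk, ho⟩
    obtain ⟨o', ho', hn⟩ := D.exists_strand (fun l s => shift w left s l (o l)) w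
    -- These labels are not classical in `D`, so the default value already colours the crossings
    -- with `ω` correctly.
    have hν : ∀ i, ∀ a ∈ D.word i, a.kind ≠ .virt → o' (ν a.label a.rising) = w :=
      fun i a ha hk => hn _ (not_classical i a ha hk)
    refine ⟨⟨w, Fin.snoc (α := fun _ => X) base w, o'⟩, ⟨by simp, fun i => ?_, fun l hl =>
      hn l fun h => hl (classical_of l h)⟩, rfl, fun i => by simp, ho'⟩
    refine Fin.lastCases ?_ (fun i => ?_) i
    · simpa using (walk_omega o' w).2 hν
    · simpa using (walk_word o' i (base i)).2
        ((walk_flatMap_flank left ν w (hν i) (ho' i) _ _).2 (hwalk i))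
  · rintro X _ ⟨w, base, o'⟩ ⟨hw, hwalk, ho⟩
    -- The opposite twist `gauge w (!s)` undoes `shift`.
    obtain ⟨o, ho, hn⟩ := D.exists_strand
      (fun l s => if s = left l then gauge w (!s) (o' l) else o' l) w
    dsimp only at hw hwalk
    have hν := (walk_omega o' w).1 (by simpa only [hw] using hwalk (Fin.last n))
    have hr : ∀ i, ∀ a ∈ D.word i, ∀ s, a.kind = .ofSign s →
        o' a.label = shift w left s a.label (o a.label) := by
      intro i a ha s hs
      rw [ho i a ha s hs, shift]
      split_ifs
      · rw [gauge_gauge_not]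
      · rfl
    refine ⟨⟨w, fun i => base i.castSucc, o⟩, ⟨fun i => ?_, hn⟩, rfl, fun i => rfl, hr⟩
    exact (walk_flatMap_flank left ν w (hν i) (hr i) _ _).1
      ((walk_word o' i _).1 (hwalk i.castSucc))
  · rintro X _ c d d' - ⟨hp, hw, hn⟩ ⟨hp', hw', hn'⟩ ⟨h1, h2, h3⟩ ⟨h1', h2', h3'⟩
    have hpt : d.pt = d'.pt := h1.symm.trans h1'
    refine Coloring.ext hpt (funext fun i => ?_) (funext fun l => ?_)
    · refine Fin.lastCases ?_ (fun i => ?_) i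
      · rw [← hp, ← hp', hpt]
      · rw [← h2, ← h2']
    -- An over-crossing passage of `E` lies either on `ω`, where its colour is that of `ω`, or on
    -- `D`, where the relation prescribes it.
    · by_cases hl : IsClassical E.word l
      · obtain ⟨i, s, hi⟩ := (E.isClassical_iff l).1 hl
        revert hi
        refine Fin.lastCases (fun hi => ?_) (fun i hi => ?_) i
        · obtain ⟨j, b, hb, hbk, hl⟩ := omega_mem _ hi (overPass_kind l s)
          have hl : l = ν b.label b.rising := congrArg Passage.label hl
          rw [hl, (walk_omega d.strand _).1 (hw _) j b hb hbk,
            (walk_omega d'.strand _).1 (hw' _) j b hb hbk, ← hp, ← hp', hpt]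
        · have hm := over_mem i _ hi (isOver_iff.2 ⟨s, rfl⟩)
          exact (h3 i _ hm s rfl).trans (h3' i _ hm s rfl).symm
      · rw [hn l hl, hn' l hl, hpt]
  · rintro X _ c c' d ⟨hw, hn⟩ ⟨hw', hn'⟩ - ⟨h1, h2, h3⟩ ⟨h1', h2', h3'⟩
    have hpt : c.pt = c'.pt := h1.trans h1'.symm
    refine Coloring.ext hpt (funext fun i => (h2 i).trans (h2' i).symm) (funext fun l => ?_)
    by_cases hl : IsClassical D.word l
    · obtain ⟨i, a, ha, rfl, hk⟩ := hl
      obtain ⟨s, hs⟩ := exists_kind hk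
      have := (h3 i a ha s hs).symm.trans (h3' i a ha s hs)
      unfold shift at this
      split_ifs at this
      · rw [← hpt] at this
        rw [← gauge_not_gauge c.pt s (c.strand a.label), this, gauge_not_gauge]
      · exact this
    · rw [hn l hl, hn' l hl, hpt]

/-! ## Invariance under reparametrization, relabelling and detour moves -/

section Reparametrize

variable {n : ℕ} {D D' : Diagram n}

/-- The new base colour is the one reached after the initial piece `u i`; walking on along `v i`
recovers the old one. -/
theorem twisted_correspondence_of_rotate (h : ∀ i, D.word i ~r D'.word i) :
    Nonempty (Correspondence (twistedTheory D) (twistedTheory D')) := by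
  have hrot : ∀ i, ∃ u v, D.word i = u ++ v ∧ D'.word i = v ++ u := by
    intro i
    obtain ⟨m, hm⟩ := h i
    refine ⟨(D.word i).take (m % (D.word i).length), (D.word i).drop (m % (D.word i).length),
      (List.take_append_drop _ _).symm, ?_⟩
    rw [← hm, List.rotate_eq_drop_append_take_mod]
  choose u v hu hv using hrot
  have hcl : ∀ l, IsClassical D'.word l ↔ IsClassical D.word l := fun l =>
    exists_congr fun i => by simp only [(h i).perm.mem_iff]
  refine ⟨{
    Rel := fun c d => c.pt = d.pt ∧ c.strand = d.strand ∧
      ∀ i, Walk (gauge c.pt) c.strand (u i) (c.base i) (d.base i)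
    map := ?_, right := ?_, left := ?_, right_unique := ?_, left_unique := ?_ }⟩
  · rintro X Y _ _ f c d ⟨h1, h2, h3⟩
    exact ⟨congrArg f h1, congrArg (f ∘ ·) h2, fun i => (h3 i).map f (map_gauge f _)⟩
  · rintro X _ ⟨w, base, o⟩ ⟨hw, hn⟩
    simp only [hu, walk_append] at hw
    choose z hz hz' using hw
    refine ⟨⟨w, z, o⟩, ⟨fun i => ?_, fun l hl => hn l ((hcl l).not.1 hl)⟩, rfl, rfl, hz⟩
    rw [hv, walk_append]
    exact ⟨_, hz' i, hz i⟩
  · rintro X _ ⟨w, base, o⟩ ⟨hw, hn⟩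
    simp only [hv, walk_append] at hw
    choose z hz hz' using hw
    refine ⟨⟨w, z, o⟩, ⟨fun i => ?_, fun l hl => hn l ((hcl l).not.2 hl)⟩, rfl, rfl, hz'⟩
    rw [hu, walk_append]
    exact ⟨_, hz' i, hz i⟩
  · rintro X _ c d d' - - - ⟨h1, h2, h3⟩ ⟨h1', h2', h3'⟩
    exact Coloring.ext (h1.symm.trans h1') (funext fun i => (h3 i).unique (h3' i))
      (h2.symm.trans h2')
  · rintro X _ ⟨w, b, o⟩ ⟨w', b', o'⟩ d ⟨hw, -⟩ ⟨hw', -⟩ - ⟨h1, h2, h3⟩ ⟨h1', h2', h3'⟩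
    obtain rfl := h1.trans h1'.symm
    obtain rfl := h2.trans h2'.symm
    refine Coloring.ext rfl (funext fun i => ?_) rfl
    have h4 := hw i
    have h5 := hw' i
    rw [hu, walk_append] at h4 h5
    obtain ⟨z, hz, hz'⟩ := h4
    obtain ⟨y, hy, hy'⟩ := h5
    rw [← (h3 i).unique hz] at hz'
    rw [← (h3' i).unique hy] at hy'
    exact hz'.unique hy'

/-! ### Relabelling crossings and renumbering components. -/

theorem cross_relabel {X : Type} [Quandle X] (γ : Bool → X → X) (o : ℕ → X) (f : ℕ → ℕ)
    (a : Passage) (x : X) :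
    cross γ o ⟨f a.label, a.kind, a.rising⟩ x = cross γ (o ∘ f) a x := by
  obtain ⟨l, _ | _ | _, _ | _⟩ := a <;> rfl

theorem isOver_relabel (f : ℕ → ℕ) (a : Passage) :
    Passage.isOver ⟨f a.label, a.kind, a.rising⟩ = a.isOver := by
  obtain ⟨l, _ | _ | _, _ | _⟩ := a <;> rfl

theorem walk_relabel {X : Type} [Quandle X] (γ : Bool → X → X) (o : ℕ → X) (f : ℕ → ℕ)
    (w : List Passage) (x y : X) :
    Walk γ o (w.map fun a => ⟨f a.label, a.kind, a.rising⟩) x y ↔ Walk γ (o ∘ f) w x y := by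
  induction w generalizing x with
  | nil => rfl
  | cons a w ih => simp [ih, cross_relabel, isOver_relabel]

theorem twisted_correspondence_of_relabel (f : Equiv.Perm ℕ)
    (h : ∀ i, D'.word i = (D.word i).map fun a => ⟨f a.label, a.kind, a.rising⟩) :
    Nonempty (Correspondence (twistedTheory D) (twistedTheory D')) := by
  have hcl : ∀ l, IsClassical D'.word (f l) ↔ IsClassical D.word l := fun l =>
    exists_congr fun i => by simp [h]
  have hcl' : ∀ l, IsClassical D'.word l ↔ IsClassical D.word (f.symm l) := fun l => by
    rw [← hcl, f.apply_symm_apply]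
  refine ⟨{
    Rel := fun c d => c.pt = d.pt ∧ c.base = d.base ∧ c.strand = d.strand ∘ f
    map := ?_, right := ?_, left := ?_, right_unique := ?_, left_unique := ?_ }⟩
  · rintro X Y _ _ g c d ⟨h1, h2, h3⟩
    exact ⟨congrArg g h1, congrArg (g ∘ ·) h2, congrArg (g ∘ ·) h3⟩
  · rintro X _ ⟨w, base, o⟩ ⟨hw, hn⟩
    have ho : o = (o ∘ f.symm) ∘ f := by
      funext l
      simp
    refine ⟨⟨w, base, o ∘ f.symm⟩, ⟨fun i => ?_, fun l hl => ?_⟩, rfl, rfl, ho⟩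
    · rw [h, walk_relabel, ← ho]
      exact hw i
    · exact hn _ ((hcl' l).not.1 hl)
  · rintro X _ ⟨w, base, o⟩ ⟨hw, hn⟩
    refine ⟨⟨w, base, o ∘ f⟩, ⟨fun i => ?_, fun l hl => ?_⟩, rfl, rfl, rfl⟩
    · rw [← walk_relabel, ← h]
      exact hw i
    · exact hn _ ((hcl l).not.2 hl)
  · rintro X _ c d d' - - - ⟨h1, h2, h3⟩ ⟨h1', h2', h3'⟩
    exact Coloring.ext (h1.symm.trans h1') (h2.symm.trans h2')
      (f.surjective.injective_comp_right (h3.symm.trans h3'))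
  · rintro X _ c c' d - - - ⟨h1, h2, h3⟩ ⟨h1', h2', h3'⟩
    exact Coloring.ext (h1.trans h1'.symm) (h2.trans h2'.symm) (h3.trans h3'.symm)

theorem twisted_correspondence_of_renumber (f : Equiv.Perm (Fin n))
    (h : ∀ i, D'.word i = D.word (f i)) :
    Nonempty (Correspondence (twistedTheory D) (twistedTheory D')) := by
  have hcl : ∀ l, IsClassical D'.word l ↔ IsClassical D.word l := fun l => by
    simp only [IsClassical, h]
    exact f.exists_congr_left.trans (by simp)
  refine ⟨{
    Rel := fun c d => c.pt = d.pt ∧ d.base = c.base ∘ f ∧ c.strand = d.strand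
    map := ?_, right := ?_, left := ?_, right_unique := ?_, left_unique := ?_ }⟩
  · rintro X Y _ _ g c d ⟨h1, h2, h3⟩
    exact ⟨congrArg g h1, congrArg (g ∘ ·) h2, congrArg (g ∘ ·) h3⟩
  · rintro X _ ⟨w, base, o⟩ ⟨hw, hn⟩
    refine ⟨⟨w, base ∘ f, o⟩, ⟨fun i => ?_, fun l hl => hn l ((hcl l).not.1 hl)⟩, rfl, rfl, rfl⟩
    rw [h]
    exact hw _
  · rintro X _ ⟨w, base, o⟩ ⟨hw, hn⟩
    refine ⟨⟨w, base ∘ f.symm, o⟩, ⟨fun i => ?_, fun l hl => hn l ((hcl l).not.2 hl)⟩, rfl, ?_, rfl⟩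
    · have := hw (f.symm i)
      rwa [h, f.apply_symm_apply] at this
    · funext i
      simp
  · rintro X _ c d d' - - - ⟨h1, h2, h3⟩ ⟨h1', h2', h3'⟩
    exact Coloring.ext (h1.symm.trans h1') (h2.trans h2'.symm) (h3.symm.trans h3')
  · rintro X _ c c' d - - - ⟨h1, h2, h3⟩ ⟨h1', h2', h3'⟩
    exact Coloring.ext (h1.trans h1'.symm)
      (f.surjective.injective_comp_right (h2.symm.trans h2')) (h3.trans h3'.symm)

/-! ### Detour moves: only classical passages matter. -/

instance sumLawfulBEq {α β : Type*} [BEq α] [LawfulBEq α] [BEq β] [LawfulBEq β] :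
    LawfulBEq (α ⊕ β) where
  eq_of_beq {a b} h := by
    cases a <;> cases b
    · exact congrArg Sum.inl (eq_of_beq h)
    · exact absurd h Bool.false_ne_true
    · exact absurd h Bool.false_ne_true
    · exact congrArg Sum.inr (eq_of_beq h)
  rfl {a} := by
    cases a
    · exact beq_self_eq_true (α := α) _
    · exact beq_self_eq_true (α := β) _

theorem Template.exists_mem {n k : ℕ} (t : Template n k) (j : Fin k) :
    ∃ i, Sum.inr j ∈ t.word i := by
  have : Sum.inr j ∈ (List.finRange n).flatMap t.word :=
    List.count_pos_iff.1 (by rw [t.hole_once j]; exact one_pos)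
  simpa using this

theorem Template.mem_fill {n k : ℕ} (t : Template n k) (f : Fin k → List Passage) (i : Fin n)
    (a : Passage) :
    a ∈ t.fill f i ↔ Sum.inl a ∈ t.word i ∨ ∃ j, Sum.inr j ∈ t.word i ∧ a ∈ f j := by
  simp [Template.fill]

/-- The classical passages of a word without holes. -/
def classicalPart (w : List Passage) : List Passage :=
  w.filter fun a => decide (a.kind ≠ .virt)

theorem classicalPart_fill {n k : ℕ} (t : Template n k) {f : Fin k → List Passage}
    (hf : ∀ j, ∀ a ∈ f j, a.kind = .virt) (i : Fin n) :
    classicalPart (t.fill f i) = (t.word i).filterMap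
      (Sum.elim (fun a => if a.kind = .virt then none else some a) fun _ => none) := by
  rw [Template.fill]
  induction t.word i with
  | nil => rfl
  | cons s u ih =>
    rw [classicalPart] at ih ⊢
    rw [List.flatMap_cons, List.filter_append, ih, List.filterMap_cons]
    obtain a | j := s
    · by_cases ha : a.kind = .virt <;> simp [ha]
    · have : (f j).filter (fun a => decide (a.kind ≠ .virt)) = [] := by
        simpa using hf j
      rw [Sum.elim_inr, this]
      rfl

/-- A template passage sharing a label with `p` is itself virtual, so deleting all such passages
leaves the classical part unchanged. The right-hand side depends only on what a detour preserves. -/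
theorem classicalPart_fill_eq (t : Template n 1) (p : List Passage)
    (hp : ∀ a ∈ p, a.kind = .virt) (h : D.word = t.fill ![p]) (i : Fin n) :
    classicalPart (D.word i) = ((t.word i).filter
      (Sum.elim (fun a => decide (a.label ∉ p.map Passage.label)) fun _ => true)).filterMap
      (Sum.elim (fun a => if a.kind = .virt then none else some a) fun _ => none) := by
  rw [h, classicalPart_fill t (by simpa using hp), List.filterMap_filter]
  refine List.filterMap_congr fun s hs => ?_
  obtain a | j := s
  · by_cases ha : a.label ∈ p.map Passage.label
    · obtain ⟨b, hb, hab⟩ := List.mem_map.1 ha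
      obtain ⟨j, hj⟩ := t.exists_mem 0
      have h1 : b ∈ D.word j := by
        rw [h, t.mem_fill]
        exact .inr ⟨0, hj, hb⟩
      have h2 : a ∈ D.word i := by
        rw [h, t.mem_fill]
        exact .inl hs
      have := (D.kind_eq_of_mem h1 h2 hab).symm.trans (hp b hb)
      simp [this]
    · simp only [List.mem_map] at ha
      simp [ha]
  · simp

theorem walk_classicalPart {X : Type} [Quandle X] (γ : Bool → X → X) (o : ℕ → X)
    (w : List Passage) (x y : X) : Walk γ o (classicalPart w) x y ↔ Walk γ o w x y :=
  walk_filter γ o _ (fun a _ h => by simpa using h) x y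

theorem twisted_correspondence_of_classicalPart
    (h : ∀ i, classicalPart (D.word i) = classicalPart (D'.word i)) :
    Nonempty (Correspondence (twistedTheory D) (twistedTheory D')) := by
  have hcl : ∀ l, IsClassical D.word l ↔ IsClassical D'.word l := fun l =>
    exists_congr fun i => exists_congr fun a => by
      have : a ∈ classicalPart (D.word i) ↔ a ∈ classicalPart (D'.word i) := by rw [h]
      simp only [classicalPart, List.mem_filter, decide_eq_true_eq] at this
      tauto
  refine ⟨.ofIff fun c => and_congr (forall_congr' fun i => ?_) (forall_congr' fun l => ?_)⟩
  · rw [← walk_classicalPart, h, walk_classicalPart]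
  · rw [hcl]

end Reparametrize

/-! ## Local moves -/

section Local

variable {n k : ℕ} {X Y : Type} [Quandle X] [Quandle Y]

/-- A walk along a word with holes, where `p j` and `q j` are the colours before and after the hole
`j`. -/
def HoleWalk (γ : Bool → X → X) (o : ℕ → X) (p q : Fin k → X) :
    List (Passage ⊕ Fin k) → X → X → Prop
  | [], x, y => x = y
  | .inl a :: u, x, y => (a.isOver = true → o a.label = x) ∧ HoleWalk γ o p q u (cross γ o a x) y
  | .inr j :: u, x, y => p j = x ∧ HoleWalk γ o p q u (q j) y

/-- Fill the holes of a word. -/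
def fillWord (f : Fin k → List Passage) (u : List (Passage ⊕ Fin k)) : List Passage :=
  u.flatMap (Sum.elim (fun a => [a]) f)

theorem HoleWalk.fill {γ : Bool → X → X} {o : ℕ → X} {p q : Fin k → X}
    {f : Fin k → List Passage} (hf : ∀ j, Walk γ o (f j) (p j) (q j))
    {u : List (Passage ⊕ Fin k)} {x y : X} (h : HoleWalk γ o p q u x y) :
    Walk γ o (fillWord f u) x y := by
  induction u generalizing x with
  | nil => exact h
  | cons s u ih =>
    rw [fillWord, List.flatMap_cons, walk_append]
    obtain a | j := s
    · exact ⟨_, ⟨h.1, rfl⟩, ih h.2⟩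
    · obtain ⟨rfl, h⟩ := h
      exact ⟨_, hf j, ih h⟩

theorem HoleWalk.congr {γ : Bool → X → X} {o o' : ℕ → X} {p q p' q' : Fin k → X}
    {u : List (Passage ⊕ Fin k)} (ho : ∀ a, .inl a ∈ u → a.kind ≠ .virt → o a.label = o' a.label)
    (hp : ∀ j, .inr j ∈ u → p j = p' j ∧ q j = q' j) {x y : X} (h : HoleWalk γ o p q u x y) :
    HoleWalk γ o' p' q' u x y := by
  induction u generalizing x with
  | nil => exact h
  | cons s u ih =>
    have ih : ∀ {x : X}, HoleWalk γ o p q u x y → HoleWalk γ o' p' q' u x y :=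
      ih (fun a ha => ho a (by simp [ha])) (fun j hj => hp j (by simp [hj]))
    obtain a | j := s
    · have ha := ho a (by simp)
      refine ⟨fun h' => ?_, ?_⟩
      · rw [← ha (isOver_kind h'), h.1 h']
      · rw [← cross_congr γ ha]
        exact ih h.2
    · obtain ⟨h1, h2⟩ := hp j (by simp)
      refine ⟨h1 ▸ h.1, ?_⟩
      rw [← h2]
      exact ih h.2

theorem HoleWalk.map (g : X →◃ Y) {γ : Bool → X → X} {γ' : Bool → Y → Y}
    (hγ : ∀ b x, g (γ b x) = γ' b (g x)) {o : ℕ → X} {p q : Fin k → X}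
    {u : List (Passage ⊕ Fin k)} {x y : X} (h : HoleWalk γ o p q u x y) :
    HoleWalk γ' (g ∘ o) (g ∘ p) (g ∘ q) u (g x) (g y) := by
  induction u generalizing x with
  | nil => exact congrArg g h
  | cons s u ih =>
    obtain a | j := s
    · refine ⟨fun h' => congrArg g (h.1 h'), ?_⟩
      rw [← map_cross g hγ]
      exact ih h.2
    · exact ⟨congrArg g h.1, ih h.2⟩

/-- The starting colour determines the colour on reaching each hole, and the word in the hole
determines the colour on leaving it. -/
theorem HoleWalk.unique {γ : Bool → X → X} {o : ℕ → X} {p q p' q' : Fin k → X}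
    {f : Fin k → List Passage} (hf : ∀ j, Walk γ o (f j) (p j) (q j))
    (hf' : ∀ j, Walk γ o (f j) (p' j) (q' j)) {u : List (Passage ⊕ Fin k)} {x y y' : X}
    (h : HoleWalk γ o p q u x y) (h' : HoleWalk γ o p' q' u x y') {j : Fin k} (hj : .inr j ∈ u) :
    p j = p' j ∧ q j = q' j := by
  induction u generalizing x with
  | nil => simp at hj
  | cons s u ih =>
    obtain a | i := s
    · exact ih h.2 h'.2 (by simpa using hj)
    · have h1 : p i = p' i := h.1.trans h'.1.symm
      have h2 : q i = q' i := (hf i).unique (h1 ▸ hf' i)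
      obtain hj | hj := List.mem_cons.1 hj
      · obtain rfl := Sum.inr_injective hj
        exact ⟨h1, h2⟩
      · exact ih h.2 (h2 ▸ h'.2) hj

theorem exists_holeWalk {γ : Bool → X → X} {o : ℕ → X} {f : Fin k → List Passage}
    {u : List (Passage ⊕ Fin k)} (hu : ∀ j : Fin k, u.count (.inr j) ≤ 1) {x y : X}
    (h : Walk γ o (fillWord f u) x y) :
    ∃ p q : Fin k → X, HoleWalk γ o p q u x y ∧
      ∀ j, .inr j ∈ u → Walk γ o (f j) (p j) (q j) := by
  induction u generalizing x with
  | nil => exact ⟨fun _ => x, fun _ => x, h, by simp⟩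
  | cons s u ih =>
    rw [fillWord, List.flatMap_cons, walk_append] at h
    obtain ⟨z, hz, h⟩ := h
    obtain ⟨p, q, h1, h2⟩ := ih (fun j => le_trans List.count_le_count_cons (hu j)) h
    obtain a | i := s
    · obtain ⟨h3, rfl⟩ := hz
      exact ⟨p, q, ⟨h3, h1⟩, fun j hj => h2 j (by simpa using hj)⟩
    -- Since `i` does not occur again, its colours can be overwritten without disturbing the rest of
    -- the walk.
    · have hi : .inr i ∉ u := by
        have := hu i
        rw [List.count_cons_self] at this
        exact List.count_eq_zero.1 (by omega)
      have hne : ∀ j, .inr j ∈ u → j ≠ i := by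
        rintro j hj rfl
        exact hi hj
      refine ⟨Function.update p i x, Function.update q i z, ⟨by simp, ?_⟩, fun j hj => ?_⟩
      · rw [Function.update_self]
        exact h1.congr (fun _ _ _ => rfl) fun j hj => by simp [hne j hj]
      · by_cases hji : j = i
        · subst hji
          simpa using hz
        · simpa [hji] using h2 j (by simpa [hji] using hj)

/-! ### Cutting a coloured diagram at the holes of a template. -/

theorem Template.index_eq (t : Template n k) {j : Fin k} {i i' : Fin n}
    (h : Sum.inr j ∈ t.word i) (h' : Sum.inr j ∈ t.word i') : i = i' := by
  by_contra hne
  have h1 := t.hole_once j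
  rw [List.count_flatMap] at h1
  have h2 : ∀ m, Sum.inr j ∈ t.word m → 1 ≤ (t.word m).count (Sum.inr j) := fun m hm =>
    List.count_pos_iff.2 hm
  have h3 : ((List.finRange n).map (List.count (Sum.inr j) ∘ t.word)).sum =
      ∑ m, (t.word m).count (Sum.inr j) := by
    rw [← List.ofFn_eq_map, List.sum_ofFn]
    rfl
  rw [h3] at h1
  have h4 := Finset.add_le_sum (f := fun m => (t.word m).count (Sum.inr j)) (s := Finset.univ)
    (fun _ _ => Nat.zero_le _) (Finset.mem_univ i) (Finset.mem_univ i') hne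
  have := h2 i h
  have := h2 i' h'
  omega

theorem Template.count_le_one (t : Template n k) (i : Fin n) (j : Fin k) :
    (t.word i).count (Sum.inr j) ≤ 1 := by
  rw [← t.hole_once j]
  rw [List.flatMap_def]
  exact (List.sublist_flatten_of_mem (List.mem_map_of_mem (List.mem_finRange i))).count_le _

theorem Template.exists_holeWalk (t : Template n k) {γ : Bool → X → X} {o : ℕ → X}
    {f : Fin k → List Passage} {x y : Fin n → X} (h : ∀ i, Walk γ o (t.fill f i) (x i) (y i)) :
    ∃ p q : Fin k → X, (∀ i, HoleWalk γ o p q (t.word i) (x i) (y i)) ∧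
      ∀ j, Walk γ o (f j) (p j) (q j) := by
  choose i hi using t.exists_mem
  choose p q hw hf using fun i => VirtualLink.exists_holeWalk (t.count_le_one i) (h i)
  refine ⟨fun j => p (i j) j, fun j => q (i j) j, fun m => ?_, fun j => hf _ j (hi j)⟩
  refine (hw m).congr (fun _ _ _ => rfl) fun j hj => ?_
  rw [t.index_eq hj (hi j)]
  exact ⟨rfl, rfl⟩

/-! ### Exchanging local pictures with the same boundary colours. -/

/-- The strands `f` of a local picture with crossings in `L` are coloured such that the `j`-th
strand starts with `p j` and ends with `q j`. -/
def LocalColoring (L : Set ℕ) (f : Fin k → List Passage) (w : X) (o : ℕ → X) (p q : Fin k → X) :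
    Prop :=
  (∀ j, Walk (gauge w) o (f j) (p j) (q j)) ∧ ∀ l ∈ L, ¬ IsClassical f l → o l = w

/-- Two local pictures have the same boundary colours, and the boundary determines the colours. -/
structure LocallyEquivalent (L : Set ℕ) (f f' : Fin k → List Passage) : Prop where
  mem : ∀ j, ∀ a ∈ f j, a.kind ≠ .virt → a.label ∈ L
  unique : ∀ {X : Type} [Quandle X] (w : X) (o o' : ℕ → X) (p q : Fin k → X),
    LocalColoring L f w o p q → LocalColoring L f w o' p q → ∀ l ∈ L, o l = o' l
  exists_of : ∀ {X : Type} [Quandle X] (w : X) (o : ℕ → X) (p q : Fin k → X),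
    LocalColoring L f w o p q → ∃ o', LocalColoring L f' w o' p q

/-- Two colourings agree outside of a local picture. -/
def LocalRel (L : Set ℕ) (t : Template n k) (f f' : Fin k → List Passage) (c d : Coloring n X) :
    Prop :=
  c.pt = d.pt ∧ c.base = d.base ∧ (∀ l ∉ L, c.strand l = d.strand l) ∧
    ∃ p q : Fin k → X,
      (∀ i, HoleWalk (gauge c.pt) c.strand p q (t.word i) (c.base i) (c.base i)) ∧
      (∀ i, HoleWalk (gauge d.pt) d.strand p q (t.word i) (d.base i) (d.base i)) ∧
      (∀ j, Walk (gauge c.pt) c.strand (f j) (p j) (q j)) ∧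
      ∀ j, Walk (gauge d.pt) d.strand (f' j) (p j) (q j)

theorem LocalRel.symm {L : Set ℕ} {t : Template n k} {f f' : Fin k → List Passage}
    {c d : Coloring n X} (h : LocalRel L t f f' c d) : LocalRel L t f' f d c := by
  obtain ⟨h1, h2, h3, p, q, h4, h5, h6, h7⟩ := h
  exact ⟨h1.symm, h2.symm, fun l hl => (h3 l hl).symm, p, q, h5, h4, h7, h6⟩

theorem Template.isClassical_fill (t : Template n k) (f : Fin k → List Passage) (l : ℕ) :
    IsClassical (t.fill f) l ↔
      (∃ i, ∃ a, Sum.inl a ∈ t.word i ∧ a.label = l ∧ a.kind ≠ .virt) ∨ IsClassical f l := by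
  constructor
  · rintro ⟨i, a, ha, h⟩
    obtain ha | ⟨j, -, hj⟩ := (t.mem_fill f i a).1 ha
    · exact .inl ⟨i, a, ha, h⟩
    · exact .inr ⟨j, a, hj, h⟩
  · rintro (⟨i, a, ha, h⟩ | ⟨j, a, ha, h⟩)
    · exact ⟨i, a, (t.mem_fill f i a).2 (.inl ha), h⟩
    · obtain ⟨i, hi⟩ := t.exists_mem j
      exact ⟨i, a, (t.mem_fill f i a).2 (.inr ⟨j, hi, ha⟩), h⟩

variable {D D' : Diagram n} {t : Template n k} {f f' : Fin k → List Passage} {L : Set ℕ}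

theorem localColoring_of_valid
    (hL : ∀ i a, Sum.inl a ∈ t.word i → a.kind ≠ .virt → a.label ∉ L) (hD : D.word = t.fill f)
    {c : Coloring n X} (hc : (twistedTheory D).Valid c) {p q : Fin k → X}
    (h : ∀ j, Walk (gauge c.pt) c.strand (f j) (p j) (q j)) :
    LocalColoring L f c.pt c.strand p q := by
  refine ⟨h, fun l hl hf => hc.2 l ?_⟩
  rw [hD, t.isClassical_fill]
  rintro (⟨i, a, ha, rfl, hk⟩ | h)
  · exact hL i a ha hk hl
  · exact hf h

-- Cut the colouring at the holes, recolour the local picture with the same boundary colours, and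
-- glue: new colours on `L`, old ones elsewhere. By `hL` the classical crossings of the template do
-- not see the change.
open Classical in
theorem exists_localRel (hL : ∀ i a, Sum.inl a ∈ t.word i → a.kind ≠ .virt → a.label ∉ L)
    (hD : D.word = t.fill f) (hD' : D'.word = t.fill f') (h : LocallyEquivalent L f f')
    (h' : LocallyEquivalent L f' f) {c : Coloring n X} (hc : (twistedTheory D).Valid c) :
    ∃ d, (twistedTheory D').Valid d ∧ LocalRel L t f f' c d := by
  have hw := hc.1
  rw [hD] at hw
  obtain ⟨p, q, hpq, hf⟩ := t.exists_holeWalk hw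
  obtain ⟨o, ho, hn⟩ := h.exists_of _ _ _ _ (localColoring_of_valid hL hD hc hf)
  let o' : ℕ → X := fun l => if l ∈ L then o l else c.strand l
  have h1 : ∀ j, Walk (gauge c.pt) o' (f' j) (p j) (q j) := fun j =>
    (ho j).congr fun a ha hk => by simp only [o', h'.mem j a ha hk, if_true]
  have h2 : ∀ i, HoleWalk (gauge c.pt) o' p q (t.word i) (c.base i) (c.base i) := fun i =>
    (hpq i).congr (fun a ha hk => by simp only [o', hL i a ha hk, if_false]) fun _ _ => ⟨rfl, rfl⟩
  refine ⟨⟨c.pt, c.base, o'⟩, ⟨fun i => ?_, fun l hl => ?_⟩, rfl, rfl, fun l hl => ?_, p, q, hpq,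
    h2, hf, h1⟩
  · rw [hD']
    exact (h2 i).fill h1
  · by_cases hlL : l ∈ L
    · simp only [o', hlL, if_true]
      refine hn l hlL fun h => hl ?_
      rw [hD', t.isClassical_fill]
      exact .inr h
    · simp only [o', hlL, if_false]
      refine hc.2 l fun h3 => hl ?_
      rw [hD, t.isClassical_fill] at h3
      rw [hD', t.isClassical_fill]
      refine h3.imp_right ?_
      rintro ⟨j, a, ha, rfl, hk⟩
      exact absurd (h.mem j a ha hk) hlL
  · simp only [o', hl, if_false]

theorem LocalRel.unique (hL : ∀ i a, Sum.inl a ∈ t.word i → a.kind ≠ .virt → a.label ∉ L)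
    (hD' : D'.word = t.fill f') (h' : LocallyEquivalent L f' f) {c d d' : Coloring n X}
    (hd : (twistedTheory D').Valid d) (hd' : (twistedTheory D').Valid d')
    (h : LocalRel L t f f' c d) (hc : LocalRel L t f f' c d') : d = d' := by
  obtain ⟨h1, h2, h3, p, q, h4, -, h6, h7⟩ := h
  obtain ⟨h1', h2', h3', p', q', h4', -, h6', h7'⟩ := hc
  have hpq : ∀ j, p j = p' j ∧ q j = q' j := fun j => by
    obtain ⟨i, hi⟩ := t.exists_mem j
    exact (h4 i).unique h6 h6' (h4' i) hi
  obtain rfl : p = p' := funext fun j => (hpq j).1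
  obtain rfl : q = q' := funext fun j => (hpq j).2
  have h8 := localColoring_of_valid hL hD' hd h7
  have h8' := localColoring_of_valid hL hD' hd' h7'
  have hpt : d.pt = d'.pt := h1.symm.trans h1'
  rw [← hpt] at h8'
  refine Coloring.ext hpt (h2.symm.trans h2') (funext fun l => ?_)
  by_cases hl : l ∈ L
  · exact h'.unique _ _ _ _ _ h8 h8' l hl
  · exact (h3 l hl).symm.trans (h3' l hl)

theorem twisted_correspondence_of_local
    (hL : ∀ i a, Sum.inl a ∈ t.word i → a.kind ≠ .virt → a.label ∉ L)
    (hD : D.word = t.fill f) (hD' : D'.word = t.fill f') (h : LocallyEquivalent L f f')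
    (h' : LocallyEquivalent L f' f) :
    Nonempty (Correspondence (twistedTheory D) (twistedTheory D')) := by
  refine ⟨{
    Rel := fun c d => LocalRel L t f f' c d
    map := ?_
    right := fun c hc => exists_localRel hL hD hD' h h' hc
    left := fun d hd => ?_
    right_unique := fun c d d' _ hd hd' h1 h2 => h1.unique hL hD' h' hd hd' h2
    left_unique := fun c c' d hc hc' _ h1 h2 => h1.symm.unique hL hD h hc hc' h2.symm }⟩
  · rintro X Y _ _ g c d ⟨h1, h2, h3, p, q, h4, h5, h6, h7⟩
    exact ⟨congrArg g h1, congrArg (g ∘ ·) h2, fun l hl => congrArg g (h3 l hl), g ∘ p, g ∘ q,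
      fun i => (h4 i).map g (map_gauge g _), fun i => (h5 i).map g (map_gauge g _),
      fun j => (h6 j).map g (map_gauge g _), fun j => (h7 j).map g (map_gauge g _)⟩
  · obtain ⟨c, hc, hcd⟩ := exists_localRel hL hD' hD h' h hd
    exact ⟨c, hc, hcd.symm⟩

end Local

/-! ## Reidemeister moves -/

section Rack

variable {X : Type} [Rack X]

/-- Translation by `x ◃ y` is translation by `y` conjugated by translation by `x`. This and its
variants flatten nested actions into composites of translations. -/
theorem act_act_eq (x y z : X) : (x ◃ y) ◃ z = x ◃ y ◃ (x ◃⁻¹ z) := by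
  rw [Shelf.self_distrib, Rack.act_invAct_eq]

theorem act_invAct (x y z : X) : x ◃ (y ◃⁻¹ z) = (x ◃ y) ◃⁻¹ (x ◃ z) := by
  rw [← Rack.left_cancel (x ◃ y), ← Shelf.self_distrib, Rack.act_invAct_eq, Rack.act_invAct_eq]

theorem act_invAct_eq' (x y z : X) : (x ◃ y) ◃⁻¹ z = x ◃ y ◃⁻¹ (x ◃⁻¹ z) := by
  rw [act_invAct, Rack.act_invAct_eq]

theorem invAct_act_eq' (x y z : X) : (x ◃⁻¹ y) ◃ z = x ◃⁻¹ y ◃ (x ◃ z) := by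
  rw [← Rack.left_cancel x, Shelf.self_distrib, Rack.act_invAct_eq, Rack.act_invAct_eq]

theorem invAct_invAct_eq (x y z : X) : (x ◃⁻¹ y) ◃⁻¹ z = x ◃⁻¹ y ◃⁻¹ (x ◃ z) := by
  rw [← Rack.left_cancel x, act_invAct, Rack.act_invAct_eq, Rack.act_invAct_eq]

end Rack

theorem eq_act_self_iff {X : Type} [Quandle X] {x y : X} : x = x ◃ y ↔ x = y := by
  rw [← Rack.left_cancel x (y := x) (y' := y), Quandle.fix]

theorem eq_invAct_self_iff {X : Type} [Quandle X] {x y : X} : x = x ◃⁻¹ y ↔ x = y := by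
  rw [← Rack.left_cancel x, Rack.act_invAct_eq, Quandle.fix]

theorem kink_locallyEquivalent (l : ℕ) (s b : Bool) :
    LocallyEquivalent {l} ![[]] ![[⟨l, .ofSign s, b⟩, ⟨l, .ofSign s, !b⟩]] where
  mem j a ha := by
    fin_cases j
    simp at ha
  unique w o o' p q h h' m hm := by
    have : ¬ IsClassical (![[]] : Fin 1 → List Passage) m := by simp [IsClassical]
    rw [h.2 m hm this, h'.2 m hm this]
  exists_of w o p q h := by
    have h0 : p 0 = q 0 := h.1 0
    -- If `s = b`, the over-crossing passage comes first and has the incoming colour. Otherwise the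
    -- under-crossing passage comes first, and idempotence forces the twisted incoming colour.
    refine ⟨fun _ => if s = b then p 0 else gauge w b (p 0), ?_, ?_⟩
    · intro j
      fin_cases j
      cases s <;> cases b <;>
        simp [cross, gauge, Passage.isOver, Kind.ofSign, h0]
    · rintro m rfl hm
      exact absurd ⟨0, ⟨m, .ofSign s, b⟩, by simp, rfl, ofSign_ne_virt s⟩ hm

theorem kink_locallyEquivalent' (l : ℕ) (s b : Bool) :
    LocallyEquivalent {l} ![[⟨l, .ofSign s, b⟩, ⟨l, .ofSign s, !b⟩]] ![[]] where
  mem j a ha := by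
    fin_cases j
    simp at ha
    rcases ha with rfl | rfl <;> simp
  unique w o o' p q h h' m hm := by
    obtain rfl : m = l := hm
    have h := h.1 0
    have h' := h'.1 0
    cases s <;> cases b <;>
      simp [cross, gauge, Passage.isOver, Kind.ofSign, eq_act_self_iff, eq_invAct_self_iff]
        at h h' <;>
      rw [h.1, h'.1]
  exists_of w o p q h := by
    -- The empty picture has no crossings, so only the default value is admissible.
    refine ⟨fun _ => w, ?_, fun _ _ _ => rfl⟩
    have h := h.1 0
    intro j
    fin_cases j
    cases s <;> cases b <;>
      simp [cross, gauge, Passage.isOver, Kind.ofSign, eq_act_self_iff, eq_invAct_self_iff]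
        at h ⊢ <;>
      simpa [h.1] using h.2

theorem bigon_locallyEquivalent (x y : ℕ) (s b : Bool) (hxy : x ≠ y) :
    LocallyEquivalent {x, y} ![[], []] ![[overPass x s, overPass y !s],
      ordered b (underPass x s) (underPass y !s)] where
  mem j a ha := by
    fin_cases j <;> simp at ha
  unique w o o' p q h h' m hm := by
    have : ¬ IsClassical (![[], []] : Fin 2 → List Passage) m := by
      simp [IsClassical]
    rw [h.2 m hm this, h'.2 m hm this]
  exists_of w o p q h := by
    have h0 : p 0 = q 0 := h.1 0
    have h1 : p 1 = q 1 := h.1 1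
    -- The upper strand meets `y` after being twisted at `x`. The second twist cancels the first,
    -- and so do the two actions on the lower strand.
    refine ⟨fun l => if l = x then p 0 else gauge w s (p 0), ?_, ?_⟩
    · intro j
      fin_cases j <;> cases s <;> cases b <;>
        simp [cross, gauge, Passage.isOver, Kind.ofSign, h0, h1, overPass, underPass, ordered,
          hxy.symm, act_act_eq, invAct_invAct_eq]
    · rintro m (rfl | rfl) hm
      · exact absurd ⟨0, overPass m s, by simp, rfl, overPass_kind _ _⟩ hm
      · exact absurd ⟨0, overPass m !s, by simp, rfl, overPass_kind _ _⟩ hm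

theorem mem_ordered {d : Bool} {a p q : Passage} : a ∈ ordered d p q ↔ a = p ∨ a = q := by
  cases d <;> simp [ordered, or_comm]

theorem bigon_locallyEquivalent' (x y : ℕ) (s b : Bool) :
    LocallyEquivalent {x, y} ![[overPass x s, overPass y !s],
      ordered b (underPass x s) (underPass y !s)] ![[], []] where
  mem j a ha := by
    fin_cases j <;> simp [mem_ordered] at ha <;>
      rcases ha with rfl | rfl <;> simp [overPass, underPass]
  unique w o o' p q h h' m hm := by
    have h := h.1 0
    have h' := h'.1 0
    cases s <;>
      simp [cross, gauge, Passage.isOver, Kind.ofSign, overPass] at h h' <;>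
      rcases hm with rfl | rfl <;> simp [h, h']
  exists_of w o p q h := by
    refine ⟨fun _ => w, ?_, fun _ _ _ => rfl⟩
    have h0 := h.1 0
    have h1 := h.1 1
    intro j
    fin_cases j <;> cases s <;> cases b <;>
      simp [cross, gauge, Passage.isOver, Kind.ofSign, overPass, underPass, ordered] at h0 h1 ⊢ <;>
      simp_all [act_act_eq, invAct_invAct_eq]

/-- The first strand determines the colours at `x` and `y`, the second one that at `z`. The third
strand must then end alike in both positions, an identity between composites of translations checked
in each of the sixteen cases. -/
theorem triangle_locallyEquivalent (a b c e : Bool) {x y z : ℕ} (hxy : x ≠ y) (hxz : x ≠ z)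
    (hyz : y ≠ z) :
    LocallyEquivalent {x, y, z} (triangle a b c e x y (overPass z c) (underPass z c))
      (triangle a b c (!e) x y (overPass z c) (underPass z c)) where
  mem j p hp := by
    fin_cases j <;> simp [triangle, mem_ordered] at hp <;>
      rcases hp with rfl | rfl <;> simp [overPass, underPass]
  unique w o o' p q h h' m hm := by
    have h0 := h.1 0
    have h1 := h.1 1
    have h0' := h'.1 0
    have h1' := h'.1 1
    cases a <;> cases b <;> cases c <;> cases e <;>
      simp [cross, gauge, Passage.isOver, Kind.ofSign, overPass, underPass, ordered, triangle]
        at h0 h1 h0' h1' <;>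
      rcases hm with rfl | rfl | rfl <;> simp [h0, h0', h1, h1']
  exists_of w o p q h := by
    have h0 := h.1 0
    have h1 := h.1 1
    have h2 := h.1 2
    suffices H : ∃ ox oy oz, ∀ j, Walk (gauge w)
        (fun l => if l = x then ox else if l = y then oy else oz)
        (triangle a b c (!e) x y (overPass z c) (underPass z c) j) (p j) (q j) by
      obtain ⟨ox, oy, oz, H⟩ := H
      refine ⟨_, H, ?_⟩
      rintro m (rfl | rfl | rfl) hm
      · exact absurd ⟨0, overPass m a, by simp [triangle, mem_ordered], rfl, overPass_kind _ _⟩ hm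
      · exact absurd ⟨0, overPass m b, by simp [triangle, mem_ordered], rfl, overPass_kind _ _⟩ hm
      · exact absurd ⟨1, overPass m c, by simp [triangle, mem_ordered], rfl, overPass_kind _ _⟩ hm
    clear h
    cases a <;> cases b <;> cases c <;> cases e <;>
      simp [cross, gauge, Passage.isOver, Kind.ofSign, overPass, underPass, ordered, triangle,
        Fin.forall_fin_succ, hxy.symm, hxz.symm, hyz.symm] at h0 h1 h2 ⊢ <;>
      obtain ⟨hx, hy, h0⟩ := h0 <;> obtain ⟨hz, h1⟩ := h1 <;>
      simp [← h0, ← h1, ← h2, hx, hy, hz, act_act_eq, act_invAct_eq', invAct_act_eq',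
        invAct_invAct_eq]

/-! ## Invariance -/

section Moves

variable {n k : ℕ} {D D' : Diagram n} {t : Template n k} {f f' : Fin k → List Passage}

/-! ### Crossings in the holes of a diagram, and invariance under moves. -/

theorem Diagram.fill_disjoint (hD : D.word = t.fill f) {i i' : Fin n} {s s' : Passage ⊕ Fin k}
    (hs : s ∈ t.word i) (hs' : s' ∈ t.word i') (hne : s ≠ s') {a : Passage}
    (ha : a ∈ Sum.elim (fun b => [b]) f s) (ha' : a ∈ Sum.elim (fun b => [b]) f s') : False := by
  have hm : ∀ {i s}, s ∈ t.word i → a ∈ Sum.elim (fun b => [b]) f s → a ∈ D.word i :=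
    fun {i s} hs ha => by
      rw [hD]
      exact List.mem_flatMap.2 ⟨s, hs, ha⟩
  obtain rfl := D.index_eq (hm hs ha) (hm hs' ha')
  have h := D.nodup_word i
  rw [hD, Template.fill, List.nodup_flatMap] at h
  have : Std.Symm (Function.onFun List.Disjoint (Sum.elim (fun b => [b]) f)) :=
    ⟨fun _ _ h => h.symm⟩
  exact h.2.forall hs hs' hne ha ha'

theorem Diagram.hole_index_eq (hD : D.word = t.fill f) {j j' : Fin k} {a : Passage}
    (ha : a ∈ f j) (ha' : a ∈ f j') : j = j' := by
  by_contra hne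
  obtain ⟨i, hi⟩ := t.exists_mem j
  obtain ⟨i', hi'⟩ := t.exists_mem j'
  exact D.fill_disjoint hD hi hi' (fun h => hne (Sum.inr_injective h)) ha ha'

theorem Diagram.mem_word_of_hole (hD : D.word = t.fill f) {j : Fin k} {a : Passage}
    (ha : a ∈ f j) : ∃ i, a ∈ D.word i := by
  obtain ⟨i, hi⟩ := t.exists_mem j
  exact ⟨i, hD ▸ (t.mem_fill f i a).2 (.inr ⟨j, hi, ha⟩)⟩

theorem Diagram.hole_kind_eq (hD : D.word = t.fill f) {j j' : Fin k} {a b : Passage}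
    (ha : a ∈ f j) (hb : b ∈ f j') (h : a.label = b.label) : a.kind = b.kind := by
  obtain ⟨i, hi⟩ := D.mem_word_of_hole hD ha
  obtain ⟨i', hi'⟩ := D.mem_word_of_hole hD hb
  exact D.kind_eq_of_mem hi hi' h

/-- Both passages through such a crossing already lie in holes, so neither can occur again outside
them. -/
theorem Diagram.template_label_not_mem (hD : D.word = t.fill f) {L : Set ℕ}
    (hL : ∀ l ∈ L, ∃ s, (∃ j, overPass l s ∈ f j) ∧ ∃ j, underPass l s ∈ f j) (i : Fin n)
    (a : Passage) (ha : Sum.inl a ∈ t.word i) (hk : a.kind ≠ .virt) : a.label ∉ L := by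
  intro hl
  obtain ⟨s, ⟨j, hj⟩, j', hj'⟩ := hL _ hl
  have hai : a ∈ D.word i := hD ▸ (t.mem_fill f i a).2 (.inl ha)
  obtain ⟨m, hm⟩ := t.exists_mem j
  obtain ⟨m', hm'⟩ := t.exists_mem j'
  obtain ⟨i', hi'⟩ := D.mem_word_of_hole hD hj
  have hks := D.kind_eq_of_mem hai hi' rfl
  obtain ⟨s', h⟩ := eq_overPass_or_underPass hk
  have hs : s' = s := by
    refine ofSign_inj (Eq.trans ?_ hks)
    obtain h | h := h <;> rw [h] <;> rfl
  subst hs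
  obtain h | h := h
  · exact D.fill_disjoint hD ha hm (by simp) (a := a) (by simp) (by rw [h]; exact hj)
  · exact D.fill_disjoint hD ha hm' (by simp) (a := a) (by simp) (by rw [h]; exact hj')

theorem Move.correspondence (h : Move D D') :
    Nonempty (Correspondence (twistedTheory D) (twistedTheory D')) := by
  cases h with
  | rotate h => exact twisted_correspondence_of_rotate h
  | relabel f h => exact twisted_correspondence_of_relabel f h
  | renumber f h => exact twisted_correspondence_of_renumber f h
  | reidemeister1 t l s b h h' =>
    refine twisted_correspondence_of_local (L := {l}) ?_ h h' (kink_locallyEquivalent l s b)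
      (kink_locallyEquivalent' l s b)
    refine D'.template_label_not_mem h' ?_
    rintro _ rfl
    refine ⟨s, ⟨0, ?_⟩, 0, ?_⟩ <;> cases s <;> cases b <;> simp [overPass, underPass]
  | reidemeister2 t x y s b h h' =>
    refine twisted_correspondence_of_local (L := {x, y}) ?_ h h'
      (bigon_locallyEquivalent x y s b ?_) (bigon_locallyEquivalent' x y s b)
    · refine D'.template_label_not_mem h' ?_
      rintro _ (rfl | rfl)
      · exact ⟨s, ⟨0, by simp⟩, 1, by simp [mem_ordered]⟩
      · exact ⟨!s, ⟨0, by simp⟩, 1, by simp [mem_ordered]⟩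
    · intro hxy
      have := ofSign_inj (D'.hole_kind_eq h' (j := 0) (j' := 0) (a := overPass x s)
        (b := overPass y !s) (by simp) (by simp) hxy)
      simp at this
  | reidemeister3 t x y z a b c e h h' =>
    have h1 : overPass x a ∈ triangle a b c e x y (overPass z c) (underPass z c) 0 := by
      simp [triangle, mem_ordered]
    have h2 : overPass y b ∈ triangle a b c e x y (overPass z c) (underPass z c) 0 := by
      simp [triangle, mem_ordered]
    have h3 : underPass x a ∈ triangle a b c e x y (overPass z c) (underPass z c) 1 := by
      simp [triangle, mem_ordered]
    have h4 : overPass z c ∈ triangle a b c e x y (overPass z c) (underPass z c) 1 := by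
      simp [triangle, mem_ordered]
    have h5 : underPass y b ∈ triangle a b c e x y (overPass z c) (underPass z c) 2 := by
      simp [triangle, mem_ordered]
    have h6 : underPass z c ∈ triangle a b c e x y (overPass z c) (underPass z c) 2 := by
      simp [triangle, mem_ordered]
    -- Equal labels would force equal signs, so that the same passage would lie in two different
    -- holes.
    have hxy : x ≠ y := by
      rintro rfl
      obtain rfl := ofSign_inj (D.hole_kind_eq h h1 h2 rfl)
      exact absurd (D.hole_index_eq h h3 h5) (by decide)
    have hxz : x ≠ z := by
      rintro rfl
      obtain rfl := ofSign_inj (D.hole_kind_eq h h1 h4 rfl)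
      exact absurd (D.hole_index_eq h h1 h4) (by decide)
    have hyz : y ≠ z := by
      rintro rfl
      obtain rfl := ofSign_inj (D.hole_kind_eq h h2 h4 rfl)
      exact absurd (D.hole_index_eq h h2 h4) (by decide)
    refine twisted_correspondence_of_local (L := {x, y, z}) ?_ h h'
      (triangle_locallyEquivalent a b c e hxy hxz hyz) ?_
    · refine D.template_label_not_mem h ?_
      rintro _ (rfl | rfl | rfl)
      · exact ⟨a, ⟨0, h1⟩, 1, h3⟩
      · exact ⟨b, ⟨0, h2⟩, 2, h5⟩
      · exact ⟨c, ⟨1, h4⟩, 2, h6⟩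
    -- Reversing the triangle is an involution, so the same lemma at `!e` gives the converse.
    · simpa using triangle_locallyEquivalent a b c (!e) hxy hxz hyz
  | detour t t' p p' hp hp' h h' hrest =>
    refine twisted_correspondence_of_classicalPart fun i => ?_
    rw [classicalPart_fill_eq t p hp h, classicalPart_fill_eq t' p' hp' h', hrest]

theorem Equivalent.represents_iff (h : Equivalent D D') (Q : Type) [Quandle Q] :
    (twistedTheory D).Represents Q ↔ (twistedTheory D').Represents Q := by
  induction h with
  | rel _ _ h => exact h.correspondence.some.represents_iff Q
  | refl => rfl
  | symm _ _ _ ih => exact ih.symm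
  | trans _ _ _ _ _ ih ih' => exact ih.trans ih'

/-! ### The ωOCC move. -/

theorem walk_fillWord_congr {X : Type} [Quandle X] {γ : Bool → X → X} {o : ℕ → X}
    (h : ∀ j x y, Walk γ o (f j) x y ↔ Walk γ o (f' j) x y) (u : List (Passage ⊕ Fin k)) (x y : X) :
    Walk γ o (fillWord f u) x y ↔ Walk γ o (fillWord f' u) x y := by
  induction u generalizing x with
  | nil => rfl
  | cons s u ih =>
    simp only [fillWord, List.flatMap_cons, walk_append] at ih ⊢
    refine exists_congr fun z => and_congr ?_ (ih z)
    obtain a | j := s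
    · rfl
    · exact h j x z

/-- Over-crossing and virtual passages leave colours unchanged. The order of two over-crossings is
irrelevant, and a virtual passage may be exchanged with an under-crossing, so the same colourings
are valid on both sides. -/
theorem OmegaOCC.correspondence {E E' : Diagram (n + 1)} (h : OmegaOCC E E') :
    Nonempty (Correspondence (plainTheory E) (plainTheory E')) := by
  obtain ⟨t, x, y, z, a, b, c, e, -, h, h'⟩ := h
  refine ⟨.ofIff fun d => and_congr Iff.rfl (and_congr (forall_congr' fun i => ?_)
    (forall_congr' fun l => ?_))⟩
  · rw [h, h']
    refine walk_fillWord_congr (fun j u v => ?_) _ _ _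
    fin_cases j <;> cases a <;> cases b <;> cases c <;> cases e <;>
      simp [triangle, ordered, overPass, underPass, Kind.ofSign, Passage.isOver, cross] <;>
      exact and_left_comm
  · have hc : IsClassical E.word l ↔ IsClassical E'.word l := by
      rw [h, h', t.isClassical_fill, t.isClassical_fill]
      refine or_congr Iff.rfl (exists_congr fun j => exists_congr fun p => and_congr ?_ Iff.rfl)
      fin_cases j <;> simp [triangle, mem_ordered]
    rw [hc]

end Moves

end VirtualLink

/-! ### The theorem. -/

theorem mainTheorem6 {n : ℕ} :
    (∀ (D₀ D₁ : VirtualLink.Diagram n) (E₀ E₁ : VirtualLink.Diagram (n + 1)),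
      VirtualLink.Equivalent D₀ D₁ → VirtualLink.IsZh D₀ E₀ → VirtualLink.IsZh D₁ E₁ →
      ∃ f : VirtualLink.FundamentalQuandle E₀ →◃ VirtualLink.FundamentalQuandle E₁,
        Function.Bijective f) ∧
    (∀ E E' : VirtualLink.Diagram (n + 1), VirtualLink.OmegaOCC E E' →
      ∃ f : VirtualLink.FundamentalQuandle E →◃ VirtualLink.FundamentalQuandle E',
        Function.Bijective f) := by
  refine ⟨fun D₀ D₁ E₀ E₁ h h₀ h₁ => ?_, fun E E' h => ?_⟩
  · obtain ⟨S₀⟩ := h₀.correspondence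
    obtain ⟨S₁⟩ := h₁.correspondence
    have h₂ := S₀.symm.represents (VirtualLink.fundamentalQuandle_represents E₀)
    have h₃ := S₁.represents ((h.represents_iff _).1 h₂)
    exact h₃.exists_iso (VirtualLink.fundamentalQuandle_represents E₁)
  · obtain ⟨S⟩ := h.correspondence
    exact (S.represents (VirtualLink.fundamentalQuandle_represents E)).exists_iso
      (VirtualLink.fundamentalQuandle_represents E')
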